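/- Let $n\ge 1$ and let $\mathbb S^{2n+1}=\{z\in\mathbb C^{n+1}:|z|=1\}$ carry the round metric $g$ induced by the real part of the Hermitian product, with Levi-Civita connection $\nabla^g$ and outward unit normal $N_z=z$. Let $\xi_z=-iz$ be the Hopf vector field, $\eta=g(\cdot,\xi)$, let $\psi$ be the endomorphism field determined by $iX=\psi(X)+\eta(X)N$ with $\psi(X)$ tangent, and put $\Phi(X,Y)=g(X,\psi(Y))$. For $r\in\mathbb R$ consider the ($\mathrm{SU}(n+1)$-invariant, metric, totally skew-torsion) affine connection $$\nabla_XY=\nabla^g_XY+r\bigl(\Phi(X,Y)\,\xi-\eta(X)\,\psi(Y)+\eta(Y)\,\psi(X)\bigr).$$ For an affine connection $\nabla$ with curvature $R^\nabla(X,Y)Z=\nabla_X\nabla_YZ-\nabla_Y\nabla_XZ-\nabla_{[X,Y]}Z$, let $\mathrm{Ric}^\nabla(X,Y)=\operatorname{tr}\bigl(Z\mapsto R^\nabla(Z,X)Y\bigr)$, let $\mathrm{Sym}(\mathrm{Ric}^\nabla)$ be its symmetric part, and let $s^\nabla$ be the trace of $\mathrm{Ric}^\nabla$ with respect to $g$.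 (i) For every $r\in\mathbb R$, the connection $\nabla$ displayed above satisfies $$\mathrm{Sym}(\mathrm{Ric}^\nabla)=2(n-r^2)\,g-2(n-1)r^2\,\eta\otimes\eta,\qquad s^\nabla=2n(2n+1)-6nr^2 .$$ (ii) Suppose $n\ge 4$. A smooth affine connection $\nabla$ on $\mathbb S^{2n+1}$ is called $\mathrm{SU}(n+1)$-invariant if $\tau_\sigma(\nabla_XY)=\nabla_{\tau_\sigma(X)}\tau_\sigma(Y)$ for all $\sigma\in\mathrm{SU}(n+1)$ and all smooth vector fields $X,Y$, where $\tau_\sigma(X)_z=(\tau_\sigma)_*(X_{\sigma^{-1}z})$ and $\tau_\sigma(z)=\sigma z$. It is called $\nabla$-Einstein (with skew-torsion) if it is metric ($\nabla g=0$), its torsion $T(X,Y)=\nabla_XY-\nabla_YX-[X,Y]$ makes $g(T(X,Y),Z)$ totally skew-symmetric, and $\mathrm{Sym}(\mathrm{Ric}^\nabla)=\frac{s^\nabla}{2n+1}\,g$. Then a smooth affine connection $\nabla$ on $\mathbb S^{2n+1}$ is both $\mathrm{SU}(n+1)$-invariant and $\nabla$-Einstein if and only if $\nabla=\nabla^g$.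 -/

import Mathlib

open Module Metric Bundle VectorField
open scoped Manifold ContDiff

namespace RiemannCartan

/-! ### Affine connections on a manifold -/

section General

variable {E : Type*} [NormedAddCommGroup E] [NormedSpace ℝ E] [FiniteDimensional ℝ E]
  {H : Type*} [TopologicalSpace H] {I : ModelWithCorners ℝ E H}
  {M : Type*} [TopologicalSpace M] [ChartedSpace H M] [IsManifold I ∞ M]

/-- The vector field `X` is smooth. -/
def IsSmoothField (I : ModelWithCorners ℝ E H) {M : Type*} [TopologicalSpace M] [ChartedSpace H M]
    [IsManifold I ∞ M] (X : ∀ p : M, TangentSpace I p) : Prop :=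
  ContMDiff I I.tangent ∞ (fun p ↦ (TotalSpace.mk' E p (X p) : TangentBundle I M))

/-- `R(X, Y) Z = ∇_X ∇_Y Z - ∇_Y ∇_X Z - ∇_[X, Y] Z`, where `D Z p (X p)` is `(∇_X Z)_p`. -/
noncomputable def curvatureField (D : CovariantDerivative I E (TangentSpace I (M := M)))
    (X Y Z : ∀ p : M, TangentSpace I p) (p : M) : TangentSpace I p :=
  D (fun q ↦ D Z q (Y q)) p (X p) - D (fun q ↦ D Z q (X q)) p (Y p)
    - D Z p (mlieBracket I X Y p)

variable [IsManifold I 1 M]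

/-- The curvature tensor at a point: the tangent vectors are extended to vector fields that are
smooth near `p` (by tensoriality the value at `p` does not depend on the extension). -/
noncomputable def curvature (D : CovariantDerivative I E (TangentSpace I (M := M))) (p : M)
    (u v w : TangentSpace I p) : TangentSpace I p :=
  curvatureField D (FiberBundle.extend E u) (FiberBundle.extend E v) (FiberBundle.extend E w) p

/-- A basis of the tangent space at `p` (every tangent space is a copy of the model space). -/
noncomputable def tangentBasis (I : ModelWithCorners ℝ E H) (p : M) :
    Basis (Fin (finrank ℝ E)) ℝ (TangentSpace I p) :=
  finBasis ℝ E

/-- The Ricci tensor `Ric(u, v) = tr (w ↦ R(w, u) v)`. -/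
noncomputable def ricci (D : CovariantDerivative I E (TangentSpace I (M := M))) (p : M)
    (u v : TangentSpace I p) : ℝ :=
  ∑ i, (tangentBasis I p).coord i (curvature D p (tangentBasis I p i) u v)

/-- The symmetric part of the Ricci tensor. -/
noncomputable def symRicci (D : CovariantDerivative I E (TangentSpace I (M := M))) (p : M)
    (u v : TangentSpace I p) : ℝ :=
  (ricci D p u v + ricci D p v u) / 2

/-- The scalar curvature: the trace of the Ricci tensor with respect to the metric `g`. -/
noncomputable def scalarCurvature (g : ContMDiffRiemannianMetric I ∞ E (TangentSpace I (M := M)))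
    (D : CovariantDerivative I E (TangentSpace I (M := M))) (p : M) : ℝ :=
  ∑ i, ∑ j,
    (Matrix.of fun k l ↦ g.inner p (tangentBasis I p k) (tangentBasis I p l))⁻¹ i j *
      ricci D p (tangentBasis I p i) (tangentBasis I p j)

/-- `∇ g = 0`, that is `X g(Y, Z) = g(∇_X Y, Z) + g(Y, ∇_X Z)`. -/
def IsMetric (g : ContMDiffRiemannianMetric I ∞ E (TangentSpace I (M := M)))
    (D : CovariantDerivative I E (TangentSpace I (M := M))) : Prop :=
  ∀ X Y Z : ∀ p : M, TangentSpace I p, IsSmoothField I X → IsSmoothField I Y → IsSmoothField I Z →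
    ∀ p : M, mvfderiv I (fun q ↦ g.inner q (Y q) (Z q)) p (X p) =
      g.inner p (D Y p (X p)) (Z p) + g.inner p (Y p) (D Z p (X p))

variable [IsManifold I 2 M]

/-- The torsion is totally skew-symmetric: `(u, v, w) ↦ g(T(u, v), w)` is alternating. -/
def HasSkewTorsion (g : ContMDiffRiemannianMetric I ∞ E (TangentSpace I (M := M)))
    (D : CovariantDerivative I E (TangentSpace I (M := M))) : Prop :=
  ∀ (p : M) (u v w : TangentSpace I p),
    g.inner p (D.torsion p u v) w = -g.inner p (D.torsion p v u) w ∧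
      g.inner p (D.torsion p u v) w = -g.inner p (D.torsion p u w) v

/-- A metric connection with totally skew-symmetric torsion such that
`Sym Ric^∇ = (s^∇ / dim M) g`. -/
def IsEinsteinWithSkewTorsion (g : ContMDiffRiemannianMetric I ∞ E (TangentSpace I (M := M)))
    (D : CovariantDerivative I E (TangentSpace I (M := M))) : Prop :=
  IsMetric g D ∧ HasSkewTorsion g D ∧ ∀ (p : M) (u v : TangentSpace I p),
    symRicci D p u v = scalarCurvature g D p / finrank ℝ E * g.inner p u v

/-- `D` is the Levi-Civita connection of `g`: it is smooth, metric and torsion-free. -/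
def IsLeviCivita (g : ContMDiffRiemannianMetric I ∞ E (TangentSpace I (M := M)))
    (D : CovariantDerivative I E (TangentSpace I (M := M))) : Prop :=
  D.ContMDiffCovariantDerivative ∞ ∧ IsMetric g D ∧ D.torsion = 0

end General

/-! ### The sphere `S^(2n+1)` in `ℂ^(n+1)` -/

/-- The unit sphere `S^(2n+1)` of `ℂ^(n+1)`. -/
abbrev OddSphere (n : ℕ) : Type := sphere (0 : EuclideanSpace ℂ (Fin (n + 1))) 1

instance finrankFact (n : ℕ) :
    Fact (finrank ℝ (EuclideanSpace ℂ (Fin (n + 1))) = (2 * n + 1) + 1) := ⟨by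
  rw [finrank_real_of_complex, finrank_euclideanSpace_fin]; ring⟩

/-- The tangent space of the sphere at `z`. -/
abbrev TS (n : ℕ) (z : OddSphere n) : Type := TangentSpace (𝓡 (2 * n + 1)) z

theorem contMDiff_incl (n : ℕ) : ContMDiff (𝓡 (2 * n + 1)) 𝓘(ℝ, EuclideanSpace ℂ (Fin (n + 1))) ω
    (Subtype.val : OddSphere n → EuclideanSpace ℂ (Fin (n + 1))) := contMDiff_coe_sphere

/-- The differential of the inclusion `S^(2n+1) → ℂ^(n+1)`. -/
noncomputable def dIncl {n : ℕ} (z : OddSphere n) :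
    TS n z →L[ℝ] EuclideanSpace ℂ (Fin (n + 1)) :=
  mvfderiv (𝓡 (2 * n + 1)) (Subtype.val : OddSphere n → EuclideanSpace ℂ (Fin (n + 1))) z

theorem dIncl_injective {n : ℕ} (z : OddSphere n) : Function.Injective (dIncl z) :=
  injective_mvfderiv_subtypeVal_sphere z

theorem inner_dIncl {n : ℕ} (z : OddSphere n) (u : TS n z) :
    inner ℝ (z : EuclideanSpace ℂ (Fin (n + 1))) (dIncl z u) = 0 := by
  have h : dIncl z u ∈ (ℝ ∙ (z : EuclideanSpace ℂ (Fin (n + 1))))ᗮ := by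
    rw [← range_mvfderiv_subtypeVal (n := 2 * n + 1) z]
    exact ⟨u, rfl⟩
  exact Submodule.mem_orthogonal_singleton_iff_inner_right.mp h

theorem contMDiffAt_dIncl_field {n : ℕ} {k : ℕ∞ω} {X : ∀ z : OddSphere n, TS n z} {z : OddSphere n}
    (hX : ContMDiffAt (𝓡 (2 * n + 1)) (𝓡 (2 * n + 1)).tangent k
      (fun w ↦ TotalSpace.mk' (EuclideanSpace ℝ (Fin (2 * n + 1))) w (X w)) z) :
    ContMDiffAt (𝓡 (2 * n + 1)) 𝓘(ℝ, EuclideanSpace ℂ (Fin (n + 1))) k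
      (fun w ↦ dIncl w (X w)) z := by
  have h1 := ((contMDiff_incl n).contMDiff_tangentMap (m := k) le_top)
  have h2 := (contMDiff_snd_tangentBundle_modelSpace (n := k) (EuclideanSpace ℂ (Fin (n + 1)))
    𝓘(ℝ, EuclideanSpace ℂ (Fin (n + 1))))
  exact (h2.comp h1).contMDiffAt.comp z hX

theorem mdifferentiableAt_dIncl_field {n : ℕ} {X : ∀ z : OddSphere n, TS n z} {z : OddSphere n}
    (hX : MDifferentiableAt (𝓡 (2 * n + 1)) (𝓡 (2 * n + 1)).tangent
      (fun w ↦ TotalSpace.mk' (EuclideanSpace ℝ (Fin (2 * n + 1))) w (X w)) z) :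
    MDifferentiableAt (𝓡 (2 * n + 1)) 𝓘(ℝ, EuclideanSpace ℂ (Fin (n + 1)))
      (fun w ↦ dIncl w (X w)) z := by
  have h1 := ((contMDiff_incl n).contMDiff_tangentMap (m := 1) le_top)
  have h2 := (contMDiff_snd_tangentBundle_modelSpace (n := 1) (EuclideanSpace ℂ (Fin (n + 1)))
    𝓘(ℝ, EuclideanSpace ℂ (Fin (n + 1))))
  exact ((h2.comp h1).mdifferentiable one_ne_zero _).comp z hX

/-- The orthogonal projection of `ℂ^(n+1)` onto the tangent space at `z`; see `dIncl_tanProj`. -/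
noncomputable def tanProj {n : ℕ} (z : OddSphere n) :
    EuclideanSpace ℂ (Fin (n + 1)) →L[ℝ] TS n z :=
  LinearMap.toContinuousLinearMap
    ((LinearEquiv.ofInjective (dIncl z).toLinearMap (dIncl_injective z)).symm.toLinearMap ∘ₗ
      ((dIncl z).toLinearMap.range.orthogonalProjectionOnto).toLinearMap)

theorem tanProj_dIncl {n : ℕ} (z : OddSphere n) (u : TS n z) : tanProj z (dIncl z u) = u := by
  have h : (dIncl z).toLinearMap.range.orthogonalProjectionOnto (dIncl z u) =
      LinearEquiv.ofInjective (dIncl z).toLinearMap (dIncl_injective z) u :=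
    Submodule.orthogonalProjectionOnto_mem_subspace_eq_self
      (K := (dIncl z).toLinearMap.range) ⟨dIncl z u, ⟨u, rfl⟩⟩
  simp [tanProj, h]

theorem dIncl_tanProj {n : ℕ} (z : OddSphere n) (w : EuclideanSpace ℂ (Fin (n + 1))) :
    dIncl z (tanProj z w) = w - inner ℝ (z : EuclideanSpace ℂ (Fin (n + 1))) w •
      (z : EuclideanSpace ℂ (Fin (n + 1))) := by
  have h1 : dIncl z (tanProj z w) = (dIncl z).toLinearMap.range.starProjection w := by
    exact congrArg Subtype.val
      ((LinearEquiv.ofInjective (dIncl z).toLinearMap (dIncl_injective z)).apply_symm_apply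
        ((dIncl z).toLinearMap.range.orthogonalProjectionOnto w))
  have h2 : (dIncl z).toLinearMap.range = (ℝ ∙ (z : EuclideanSpace ℂ (Fin (n + 1))))ᗮ :=
    range_mvfderiv_subtypeVal (n := 2 * n + 1) z
  rw [h1]
  simp only [h2]
  rw [Submodule.starProjection_orthogonal']
  simp [Submodule.starProjection_unit_singleton ℝ (norm_eq_of_mem_sphere z)]

/-- The scalar product induced on the tangent space by the real part of the Hermitian product. -/
noncomputable def roundInner {n : ℕ} (z : OddSphere n) : TS n z →L[ℝ] TS n z →L[ℝ] ℝ :=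
  (ContinuousLinearMap.precomp ℝ (dIncl z)) ∘L (innerSL ℝ (E := EuclideanSpace ℂ (Fin (n + 1)))) ∘L dIncl z

theorem roundInner_apply {n : ℕ} (z : OddSphere n) (u v : TS n z) :
    roundInner z u v = inner ℝ (dIncl z u) (dIncl z v) := rfl

/-- The round metric of constant curvature one. -/
noncomputable def roundMetric (n : ℕ) :
    ContMDiffRiemannianMetric (𝓡 (2 * n + 1)) ∞ (EuclideanSpace ℝ (Fin (2 * n + 1)))
      (TangentSpace (𝓡 (2 * n + 1)) (M := OddSphere n)) where
  inner z := roundInner z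
  symm z u v := real_inner_comm (dIncl z v) (dIncl z u)
  pos z u hu := real_inner_self_pos.2
    (fun h ↦ hu (dIncl_injective z (h.trans (map_zero _).symm)))
  isVonNBounded z := by
    refine Bornology.IsVonNBounded.subset ?_
      ((NormedSpace.isVonNBounded_ball ℝ (EuclideanSpace ℂ (Fin (n + 1))) 1).image (tanProj z))
    intro v hv
    refine ⟨dIncl z v, ?_, tanProj_dIncl z v⟩
    have h : ‖dIncl z v‖ ^ 2 < 1 := by
      rw [← real_inner_self_eq_norm_sq]; exact hv
    simpa using (sq_lt_one_iff₀ (norm_nonneg _)).mp h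
  contMDiff := by
    intro z
    rw [contMDiffAt_hom_bundle]
    refine ⟨contMDiffAt_id, ?_⟩
    let e := trivializationAt (EuclideanSpace ℝ (Fin (2 * n + 1)))
      (TangentSpace (𝓡 (2 * n + 1)) (M := OddSphere n)) z
    let A : OddSphere n → EuclideanSpace ℝ (Fin (2 * n + 1)) →L[ℝ] EuclideanSpace ℂ (Fin (n + 1)) :=
      fun w ↦ dIncl w ∘L e.symmL ℝ w
    have hA : ContMDiffAt (𝓡 (2 * n + 1)) 𝓘(ℝ, EuclideanSpace ℝ (Fin (2 * n + 1)) →L[ℝ]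
        EuclideanSpace ℂ (Fin (n + 1))) ∞ A z := by
      refine ((contMDiff_incl n z).mfderiv_const (m := ∞) le_top).congr_of_eventuallyEq ?_
      filter_upwards with w
      ext u
      simp only [inTangentCoordinates, ContinuousLinearMap.inCoordinates, A,
        TangentBundle.continuousLinearMapAt_model_space]
      rfl
    have hB : ContDiff ℝ ∞ (fun L : EuclideanSpace ℝ (Fin (2 * n + 1)) →L[ℝ]
        EuclideanSpace ℂ (Fin (n + 1)) ↦
        ((ContinuousLinearMap.compL ℝ (EuclideanSpace ℝ (Fin (2 * n + 1)))
          (EuclideanSpace ℂ (Fin (n + 1))) ℝ).flip L) ∘L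
          ((innerSL ℝ : EuclideanSpace ℂ (Fin (n + 1)) →L[ℝ]
            EuclideanSpace ℂ (Fin (n + 1)) →L[ℝ] ℝ) ∘L L)) := by
      fun_prop
    have hC := hB.contMDiff.contMDiffAt.comp z hA
    refine hC.congr_of_eventuallyEq ?_
    filter_upwards [e.open_baseSet.mem_nhds (FiberBundle.mem_baseSet_trivializationAt' z)] with w hw
    ext u v
    rw [inCoordinates_apply_eq₂ hw hw (Set.mem_univ _)]
    simp only [Trivial.fiberBundle_trivializationAt', Trivial.linearMapAt_trivialization, LinearMap.id_coe, id_eq, roundInner_apply]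
    rw [← e.symmL_apply (R := ℝ) hw u, ← e.symmL_apply (R := ℝ) hw v]
    rfl

/-- Affine connections on the sphere. -/
abbrev Connection (n : ℕ) : Type :=
  CovariantDerivative (𝓡 (2 * n + 1)) (EuclideanSpace ℝ (Fin (2 * n + 1)))
    (TangentSpace (𝓡 (2 * n + 1)) (M := OddSphere n))

/-- The Hopf vector field `ξ_z = - i z`. -/
noncomputable def reeb {n : ℕ} (z : OddSphere n) : TS n z :=
  tanProj z (-(Complex.I • (z : EuclideanSpace ℂ (Fin (n + 1)))))

/-- The one-form `η = g(ξ, ·)`. -/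
noncomputable def eta {n : ℕ} (z : OddSphere n) : TS n z →L[ℝ] ℝ := roundInner z (reeb z)

/-- The endomorphism `ψ`: the tangential part of the multiplication by `i`, that is
`i X = ψ(X) + η(X) N` with `N` the outward unit normal. -/
noncomputable def psi {n : ℕ} (z : OddSphere n) : TS n z →L[ℝ] TS n z :=
  tanProj z ∘L (ContinuousLinearMap.lsmul ℝ ℂ Complex.I) ∘L dIncl z

/-- The two-form `Φ(u, v) = g(u, ψ(v))`. -/
noncomputable def fundForm {n : ℕ} (z : OddSphere n) (u v : TS n z) : ℝ := roundInner z u (psi z v)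

theorem roundInner_symm {n : ℕ} (z : OddSphere n) (u v : TS n z) :
    roundInner z u v = roundInner z v u :=
  real_inner_comm (dIncl z v) (dIncl z u)

/-- The tensor `(u, v) ↦ r (Φ(u, v) ξ - η(u) ψ(v) + η(v) ψ(u))`, with arguments in the order `v`, `u`;
see `skewForm_apply`. -/
noncomputable def skewForm {n : ℕ} (r : ℝ) (z : OddSphere n) : TS n z →L[ℝ] TS n z →L[ℝ] TS n z :=
  haveI : FiniteDimensional ℝ (TS n z) :=
    inferInstanceAs (FiniteDimensional ℝ (EuclideanSpace ℝ (Fin (2 * n + 1))))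
  haveI : T2Space (TS n z) := inferInstanceAs (T2Space (EuclideanSpace ℝ (Fin (2 * n + 1))))
  LinearMap.toContinuousLinearMap (E := TS n z)
   { toFun := fun v ↦ r • ((roundInner z (psi z v)).smulRight (reeb z)
        - (eta z).smulRight (psi z v) + eta z v • psi z)
     map_add' := fun v w ↦ by
        ext1 u
        simp [add_smul, smul_add]
        module
     map_smul' := fun c v ↦ by
        ext1 u
        simp [smul_smul]
        module }

theorem skewForm_apply {n : ℕ} (r : ℝ) (z : OddSphere n) (u v : TS n z) :
    skewForm r z v u = r • (fundForm z u v • reeb z - eta z u • psi z v + eta z v • psi z u) := by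
  rw [fundForm, roundInner_symm]; rfl

/-- The Levi-Civita connection of the round metric: `∇_X Y` is the tangential part of the derivative
of the `ℂ^(n+1)`-valued function `Y` along `X`; see `leviCivita_isLeviCivita`. -/
noncomputable def leviCivita (n : ℕ) : Connection n where
  toFun Y z := tanProj z ∘L mvfderiv (𝓡 (2 * n + 1)) (fun w ↦ dIncl w (Y w)) z
  isCovariantDerivativeOnUniv :=
    { add := by
        intro Y Y' z hY hY' _
        have h : (fun w ↦ dIncl w ((Y + Y') w)) =
            (fun w ↦ dIncl w (Y w)) + fun w ↦ dIncl w (Y' w) := by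
          funext w; exact map_add (dIncl w) _ _
        rw [h, mvfderiv_add (mdifferentiableAt_dIncl_field hY) (mdifferentiableAt_dIncl_field hY')]
        exact ContinuousLinearMap.comp_add _ _ _
      leibniz := by
        intro Y f z hY hf _
        have h : (fun w ↦ dIncl w ((f • Y) w)) = f • fun w ↦ dIncl w (Y w) := by
          funext w; exact map_smul (dIncl w) _ _
        rw [h, mvfderiv_smul hf (mdifferentiableAt_dIncl_field hY)]
        ext1 u
        simp [tanProj_dIncl] }

theorem leviCivita_apply {n : ℕ} (Y : ∀ z : OddSphere n, TS n z) (z : OddSphere n) (u : TS n z) :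
    leviCivita n Y z u =
      tanProj z (mvfderiv (𝓡 (2 * n + 1)) (fun w ↦ dIncl w (Y w)) z u) := rfl

/-- The connection `∇_X Y = ∇^g_X Y + r (Φ(X, Y) ξ - η(X) ψ(Y) + η(Y) ψ(X))`; see
`skewConnection_apply`. -/
noncomputable def skewConnection (n : ℕ) (r : ℝ) : Connection n :=
  (leviCivita n).addOneForm (skewForm r)

theorem skewConnection_apply {n : ℕ} (r : ℝ) (Y : ∀ z : OddSphere n, TS n z) (z : OddSphere n)
    (u : TS n z) : skewConnection n r Y z u = leviCivita n Y z u +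
      r • (fundForm z u (Y z) • reeb z - eta z u • psi z (Y z) + eta z (Y z) • psi z u) := by
  rw [← skewForm_apply]; rfl

/-- The natural action of `SU(n+1)` on the sphere. -/
noncomputable def suAct {n : ℕ} (σ : Matrix.specialUnitaryGroup (Fin (n + 1)) ℂ) (z : OddSphere n) :
    OddSphere n :=
  ⟨Matrix.toEuclideanLin (σ : Matrix (Fin (n + 1)) (Fin (n + 1)) ℂ) z, by
    have hU : Matrix.toEuclideanCLM (n := Fin (n + 1)) (𝕜 := ℂ) σ.1 ∈
        unitary (EuclideanSpace ℂ (Fin (n + 1)) →L[ℂ] EuclideanSpace ℂ (Fin (n + 1))) :=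
      Unitary.map_mem _ (Matrix.mem_specialUnitaryGroup_iff.mp σ.2).1
    rw [mem_sphere_zero_iff_norm]
    exact (ContinuousLinearMap.norm_map_of_mem_unitary hU z.1).trans (norm_eq_of_mem_sphere z)⟩

/-- `τ_σ(X)_z = (τ_σ)_* X_(σ⁻¹ z)`, written as the pullback of `X` under the inverse
diffeomorphism `τ_(σ⁻¹)`. -/
noncomputable def pushforward {n : ℕ} (σ : Matrix.specialUnitaryGroup (Fin (n + 1)) ℂ)
    (X : ∀ z : OddSphere n, TS n z) : ∀ z : OddSphere n, TS n z :=
  mpullback (𝓡 (2 * n + 1)) (𝓡 (2 * n + 1)) (suAct σ⁻¹) X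

/-- Invariance under `SU(n+1)`: `τ_σ(∇_X Y) = ∇_(τ_σ X) τ_σ(Y)`. -/
def IsSUInvariant {n : ℕ} (D : Connection n) : Prop :=
  ∀ (σ : Matrix.specialUnitaryGroup (Fin (n + 1)) ℂ) (X Y : ∀ z : OddSphere n, TS n z),
    IsSmoothField (𝓡 (2 * n + 1)) X → IsSmoothField (𝓡 (2 * n + 1)) Y →
      pushforward σ (fun z ↦ D Y z (X z)) =
        fun z ↦ D (pushforward σ Y) z (pushforward σ X z)

/-! ### The connection `leviCivita` is the Levi-Civita connection -/

theorem apply_inverse {A B : Type*} [TopologicalSpace A] [AddCommGroup A] [Module ℝ A]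
    [TopologicalSpace B] [AddCommGroup B] [Module ℝ B] {f : A →L[ℝ] B} (hf : f.IsInvertible)
    (y : B) : f (f.inverse y) = y :=
  (hf.inverse_apply_eq.mp rfl).symm

theorem mvfderiv_inner {n : ℕ} {f h : OddSphere n → EuclideanSpace ℂ (Fin (n + 1))}
    {z : OddSphere n}
    (hf : MDifferentiableAt (𝓡 (2 * n + 1)) 𝓘(ℝ, EuclideanSpace ℂ (Fin (n + 1))) f z)
    (hh : MDifferentiableAt (𝓡 (2 * n + 1)) 𝓘(ℝ, EuclideanSpace ℂ (Fin (n + 1))) h z)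
    (u : TS n z) :
    mvfderiv (𝓡 (2 * n + 1)) (fun w ↦ inner ℝ (f w) (h w)) z u =
      inner ℝ (mvfderiv (𝓡 (2 * n + 1)) f z u) (h z) +
        inner ℝ (f z) (mvfderiv (𝓡 (2 * n + 1)) h z u) := by
  have hB : ContDiff ℝ 1
      (fun p : EuclideanSpace ℂ (Fin (n + 1)) × EuclideanSpace ℂ (Fin (n + 1)) ↦
        (inner ℝ p.1 p.2 : ℝ)) := contDiff_inner
  have hfh : MDifferentiableAt (𝓡 (2 * n + 1)) 𝓘(ℝ)
      (fun w ↦ (inner ℝ (f w) (h w) : ℝ)) z :=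
    MDifferentiableAt.comp (I' := 𝓘(ℝ, EuclideanSpace ℂ (Fin (n + 1)) ×
      EuclideanSpace ℂ (Fin (n + 1)))) (f := fun w ↦ (f w, h w)) (g := fun p :
      EuclideanSpace ℂ (Fin (n + 1)) × EuclideanSpace ℂ (Fin (n + 1)) ↦ (inner ℝ p.1 p.2 : ℝ)) z
      (hB.contMDiff.mdifferentiable one_ne_zero (f z, h z)) (hf.prodMk_space hh)
  have hf' := (mdifferentiableAt_iff ..).mp hf |>.2
  have hh' := (mdifferentiableAt_iff ..).mp hh |>.2
  rw [hfh.mvfderiv, hf.mvfderiv, hh.mvfderiv]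
  simp only [ModelWithCorners.range_eq_univ, fderivWithin_univ,
    differentiableWithinAt_univ] at hf' hh' ⊢
  have key := (fun u' : EuclideanSpace ℝ (Fin (2 * n + 1)) ↦ fderiv_inner_apply ℝ hf' hh' u') u
  have h1 : writtenInExtChartAt (𝓡 (2 * n + 1)) 𝓘(ℝ, EuclideanSpace ℂ (Fin (n + 1))) z f
      (extChartAt (𝓡 (2 * n + 1)) z z) = f z := congrArg f (extChartAt_to_inv z)
  have h2 : writtenInExtChartAt (𝓡 (2 * n + 1)) 𝓘(ℝ, EuclideanSpace ℂ (Fin (n + 1))) z h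
      (extChartAt (𝓡 (2 * n + 1)) z z) = h z := congrArg h (extChartAt_to_inv z)
  rw [h1, h2] at key
  exact key.trans (add_comm _ _)

theorem inner_dIncl_tanProj {n : ℕ} (z : OddSphere n) (w : EuclideanSpace ℂ (Fin (n + 1)))
    (u : TS n z) : inner ℝ (dIncl z (tanProj z w)) (dIncl z u) = inner ℝ w (dIncl z u) := by
  rw [dIncl_tanProj, inner_sub_left, inner_smul_left, inner_dIncl]
  simp

theorem leviCivita_isMetric (n : ℕ) : IsMetric (roundMetric n) (leviCivita n) := by
  intro X Y Z _ hY hZ z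
  have hY' := mdifferentiableAt_dIncl_field ((hY z).mdifferentiableAt (by simp))
  have hZ' := mdifferentiableAt_dIncl_field ((hZ z).mdifferentiableAt (by simp))
  refine (mvfderiv_inner hY' hZ' (X z)).trans ?_
  congr 1
  · exact (inner_dIncl_tanProj z _ _).symm
  · rw [real_inner_comm]
    exact (inner_dIncl_tanProj z _ _).symm.trans (real_inner_comm _ _)

theorem dIncl_mlieBracket {n : ℕ} {X Y : ∀ z : OddSphere n, TS n z} {z : OddSphere n}
    (hX : MDifferentiableAt (𝓡 (2 * n + 1)) (𝓡 (2 * n + 1)).tangent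
      (fun w ↦ TotalSpace.mk' (EuclideanSpace ℝ (Fin (2 * n + 1))) w (X w)) z)
    (hY : MDifferentiableAt (𝓡 (2 * n + 1)) (𝓡 (2 * n + 1)).tangent
      (fun w ↦ TotalSpace.mk' (EuclideanSpace ℝ (Fin (2 * n + 1))) w (Y w)) z) :
    dIncl z (mlieBracket (𝓡 (2 * n + 1)) X Y z) =
      mvfderiv (𝓡 (2 * n + 1)) (fun w ↦ dIncl w (Y w)) z (X z) -
        mvfderiv (𝓡 (2 * n + 1)) (fun w ↦ dIncl w (X w)) z (Y z) := by
  let φ := extChartAt (𝓡 (2 * n + 1)) z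
  let G : EuclideanSpace ℝ (Fin (2 * n + 1)) → EuclideanSpace ℂ (Fin (n + 1)) :=
    fun y ↦ (φ.symm y : EuclideanSpace ℂ (Fin (n + 1)))
  let hat : (∀ z : OddSphere n, TS n z) →
      EuclideanSpace ℝ (Fin (2 * n + 1)) → EuclideanSpace ℝ (Fin (2 * n + 1)) := fun V ↦
    mpullbackWithin 𝓘(ℝ, EuclideanSpace ℝ (Fin (2 * n + 1))) (𝓡 (2 * n + 1)) φ.symm V
      (Set.range (𝓡 (2 * n + 1)))
  have hz : φ z ∈ φ.target := mem_extChartAt_target z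
  have hopen : φ.target ∈ nhds (φ z) := extChartAt_target_mem_nhds z
  have hsymm : ∀ y ∈ φ.target, MDifferentiableAt 𝓘(ℝ, EuclideanSpace ℝ (Fin (2 * n + 1)))
      (𝓡 (2 * n + 1)) φ.symm y := by
    intro y hy
    have := mdifferentiableWithinAt_extChartAt_symm (I := 𝓡 (2 * n + 1)) hy
    rwa [ModelWithCorners.range_eq_univ, mdifferentiableWithinAt_univ] at this
  have hhat : ∀ (V : ∀ z : OddSphere n, TS n z), ∀ y ∈ φ.target,
      mfderiv 𝓘(ℝ, EuclideanSpace ℝ (Fin (2 * n + 1))) (𝓡 (2 * n + 1)) φ.symm y (hat V y) =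
        V (φ.symm y) := by
    intro V y hy
    have hinv := isInvertible_mfderivWithin_extChartAt_symm (I := 𝓡 (2 * n + 1)) hy
    have h : mfderivWithin 𝓘(ℝ, EuclideanSpace ℝ (Fin (2 * n + 1))) (𝓡 (2 * n + 1)) φ.symm
        (Set.range (𝓡 (2 * n + 1))) y (hat V y) = V (φ.symm y) := apply_inverse hinv _
    rw [ModelWithCorners.range_eq_univ, mfderivWithin_univ] at h
    exact h
  have hG : ∀ (V : ∀ z : OddSphere n, TS n z), ∀ y ∈ φ.target,
      fderiv ℝ G y (hat V y) = dIncl (φ.symm y) (V (φ.symm y)) := by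
    intro V y hy
    have h1 : mfderiv 𝓘(ℝ, EuclideanSpace ℝ (Fin (2 * n + 1)))
        𝓘(ℝ, EuclideanSpace ℂ (Fin (n + 1))) G y (hat V y) =
        dIncl (φ.symm y) (mfderiv 𝓘(ℝ, EuclideanSpace ℝ (Fin (2 * n + 1))) (𝓡 (2 * n + 1))
          φ.symm y (hat V y)) :=
      mfderiv_comp_apply y ((contMDiff_incl n).mdifferentiable (by simp) (φ.symm y))
        (hsymm y hy) (hat V y)
    rw [hhat V y hy] at h1
    rw [← h1, mfderiv_eq_fderiv]
    rfl
  have hd : ∀ V : ∀ z : OddSphere n, TS n z,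
      MDifferentiableAt (𝓡 (2 * n + 1)) (𝓡 (2 * n + 1)).tangent
        (fun w ↦ TotalSpace.mk' (EuclideanSpace ℝ (Fin (2 * n + 1))) w (V w)) z →
      DifferentiableAt ℝ (hat V) (φ z) := by
    intro V hV
    have h := (mdifferentiableWithinAt_univ.mpr
      hV).differentiableWithinAt_mpullbackWithin_vectorField
    exact h.differentiableAt (by simp)
  have hGs : ContDiffAt ℝ ω G (φ z) := by
    rw [← contMDiffAt_iff_contDiffAt]
    exact (contMDiff_incl n _).comp _
      ((contMDiffOn_extChartAt_symm z).contMDiffAt hopen)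
  have hswap : ∀ V W : ∀ z : OddSphere n, TS n z,
      MDifferentiableAt (𝓡 (2 * n + 1)) (𝓡 (2 * n + 1)).tangent
        (fun w ↦ TotalSpace.mk' (EuclideanSpace ℝ (Fin (2 * n + 1))) w (W w)) z →
      fderiv ℝ (fun y ↦ fderiv ℝ G y (hat W y)) (φ z) (hat V (φ z)) =
        mvfderiv (𝓡 (2 * n + 1)) (fun w ↦ dIncl w (W w)) z (V z) := by
    intro V W hW
    have h0 : φ.symm (φ z) = z := extChartAt_to_inv z
    have h1 : (fun y ↦ fderiv ℝ G y (hat W y)) =ᶠ[nhds (φ z)]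
        ((fun w ↦ dIncl w (W w)) ∘ φ.symm) := by
      filter_upwards [hopen] with y hy using hG W y hy
    have h2 : MDifferentiableAt (𝓡 (2 * n + 1)) 𝓘(ℝ, EuclideanSpace ℂ (Fin (n + 1)))
        (fun w ↦ dIncl w (W w)) (φ.symm (φ z)) := by
      rw [h0]; exact mdifferentiableAt_dIncl_field hW
    have h3 : mfderiv 𝓘(ℝ, EuclideanSpace ℝ (Fin (2 * n + 1)))
        𝓘(ℝ, EuclideanSpace ℂ (Fin (n + 1))) ((fun w ↦ dIncl w (W w)) ∘ φ.symm) (φ z)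
          (hat V (φ z)) =
        mvfderiv (𝓡 (2 * n + 1)) (fun w ↦ dIncl w (W w)) (φ.symm (φ z))
          (mfderiv 𝓘(ℝ, EuclideanSpace ℝ (Fin (2 * n + 1))) (𝓡 (2 * n + 1))
          φ.symm (φ z) (hat V (φ z))) :=
      mfderiv_comp_apply _ h2 (hsymm _ hz) _
    rw [hhat V _ hz] at h3
    rw [h1.fderiv_eq, ← mfderiv_eq_fderiv]
    exact h3.trans (congrArg (fun p ↦
      mvfderiv (𝓡 (2 * n + 1)) (fun w ↦ dIncl w (W w)) p (V p)) h0)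
  have hinv := isInvertible_mfderiv_extChartAt (I := 𝓡 (2 * n + 1)) (mem_extChartAt_source
    (I := 𝓡 (2 * n + 1)) z)
  have hb : mfderiv (𝓡 (2 * n + 1)) 𝓘(ℝ, EuclideanSpace ℝ (Fin (2 * n + 1))) φ z
      (mlieBracket (𝓡 (2 * n + 1)) X Y z) = lieBracket ℝ (hat X) (hat Y) (φ z) := by
    have h : mfderiv (𝓡 (2 * n + 1)) 𝓘(ℝ, EuclideanSpace ℝ (Fin (2 * n + 1))) φ z
      (mlieBracket (𝓡 (2 * n + 1)) X Y z) = lieBracketWithin ℝ (hat X) (hat Y)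
      (φ.symm ⁻¹' Set.univ ∩ Set.range (𝓡 (2 * n + 1))) (φ z) := apply_inverse hinv _
    rw [ModelWithCorners.range_eq_univ, Set.preimage_univ, Set.inter_univ,
      lieBracketWithin_univ] at h
    exact h
  have hc : ∀ w : TS n z, dIncl z w = fderiv ℝ G (φ z)
      (mfderiv (𝓡 (2 * n + 1)) 𝓘(ℝ, EuclideanSpace ℝ (Fin (2 * n + 1))) φ z w) := by
    intro w
    have h1 : (Subtype.val : OddSphere n → EuclideanSpace ℂ (Fin (n + 1))) =ᶠ[nhds z] G ∘ φ := by
      filter_upwards [extChartAt_source_mem_nhds (I := 𝓡 (2 * n + 1)) z] with y hy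
      exact congrArg Subtype.val (φ.left_inv hy).symm
    have h2 := mfderiv_comp_apply (I := 𝓡 (2 * n + 1))
      (I' := 𝓘(ℝ, EuclideanSpace ℝ (Fin (2 * n + 1))))
      (I'' := 𝓘(ℝ, EuclideanSpace ℂ (Fin (n + 1)))) (g := G) (f := φ) z
      (hGs.differentiableAt (by simp)).mdifferentiableAt
      (mdifferentiableAt_extChartAt (ChartedSpace.mem_chart_source z)) w
    rw [← h1.mfderiv_eq, mfderiv_eq_fderiv] at h2
    exact h2
  rw [hc, hb, fderiv_apply_lieBracket hGs (by simp) (hd Y hY) (hd X hX), hswap X Y hY,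
    hswap Y X hX]

theorem leviCivita_torsion (n : ℕ) : (leviCivita n).torsion = 0 := by
  rw [CovariantDerivative.torsion_eq_zero_iff]
  intro X Y z hX hY
  rw [leviCivita_apply, leviCivita_apply, ← map_sub, ← dIncl_mlieBracket hX hY, tanProj_dIncl]

theorem isInvertible_of_injective {A B : Type*} [NormedAddCommGroup A] [NormedSpace ℝ A]
    [FiniteDimensional ℝ A] [NormedAddCommGroup B] [NormedSpace ℝ B] [FiniteDimensional ℝ B]
    (f : A →L[ℝ] B) (hf : Function.Injective f) (h : finrank ℝ A = finrank ℝ B) :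
    f.IsInvertible :=
  ⟨(LinearEquiv.ofInjectiveOfFinrankEq f.toLinearMap hf h).toContinuousLinearEquiv, rfl⟩

theorem finrank_dual {A : Type*} [NormedAddCommGroup A] [NormedSpace ℝ A]
    [FiniteDimensional ℝ A] : finrank ℝ A = finrank ℝ (A →L[ℝ] ℝ) :=
  (Subspace.dual_finrank_eq (K := ℝ) (V := A)).symm.trans
    (LinearMap.toContinuousLinearMap (𝕜 := ℝ) (E := A) (F' := ℝ)).finrank_eq

/-- `v ↦ ⟨v, A ·⟩`, an auxiliary map for the smoothness of `leviCivita`. -/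
noncomputable def pairL {n : ℕ} (A : EuclideanSpace ℝ (Fin (2 * n + 1)) →L[ℝ]
    EuclideanSpace ℂ (Fin (n + 1))) : EuclideanSpace ℂ (Fin (n + 1)) →L[ℝ]
      EuclideanSpace ℝ (Fin (2 * n + 1)) →L[ℝ] ℝ :=
  ((ContinuousLinearMap.compL ℝ (EuclideanSpace ℝ (Fin (2 * n + 1)))
    (EuclideanSpace ℂ (Fin (n + 1))) ℝ).flip A) ∘L
    (innerSL ℝ : EuclideanSpace ℂ (Fin (n + 1)) →L[ℝ] EuclideanSpace ℂ (Fin (n + 1)) →L[ℝ] ℝ)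

theorem pairL_apply {n : ℕ} (A : EuclideanSpace ℝ (Fin (2 * n + 1)) →L[ℝ]
    EuclideanSpace ℂ (Fin (n + 1))) (v : EuclideanSpace ℂ (Fin (n + 1)))
    (y : EuclideanSpace ℝ (Fin (2 * n + 1))) : pairL A v y = inner ℝ v (A y) := rfl

theorem contDiff_pairL {n : ℕ} : ContDiff ℝ ∞ (pairL (n := n)) := by
  unfold pairL
  fun_prop

theorem pairL_invertible {n : ℕ} (A : EuclideanSpace ℝ (Fin (2 * n + 1)) →L[ℝ]
    EuclideanSpace ℂ (Fin (n + 1))) (hA : Function.Injective A) :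
    (pairL A ∘L A).IsInvertible := by
  have hinj : Function.Injective (pairL A ∘L A) := by
    rw [injective_iff_map_eq_zero]
    intro y hy
    have h : inner ℝ (A y) (A y) = (0 : ℝ) := congrArg (fun L ↦ L y) hy
    exact hA ((inner_self_eq_zero.mp h).trans (map_zero A).symm)
  exact isInvertible_of_injective _ hinj finrank_dual

theorem leviCivita_contMDiff (n : ℕ) : (leviCivita n).ContMDiffCovariantDerivative ∞ := by
  refine ⟨⟨fun {σ} hσ z _ ↦ ContMDiffAt.contMDiffWithinAt ?_⟩⟩
  have hσ' := fun w ↦ contMDiffAt_dIncl_field (hσ.contMDiffAt (x := w) Filter.univ_mem)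
  rw [contMDiffAt_hom_bundle]
  refine ⟨contMDiffAt_id, ?_⟩
  let e := trivializationAt (EuclideanSpace ℝ (Fin (2 * n + 1)))
    (TangentSpace (𝓡 (2 * n + 1)) (M := OddSphere n)) z
  let A : OddSphere n → EuclideanSpace ℝ (Fin (2 * n + 1)) →L[ℝ] EuclideanSpace ℂ (Fin (n + 1)) :=
    fun w ↦ dIncl w ∘L e.symmL ℝ w
  let P : OddSphere n → EuclideanSpace ℝ (Fin (2 * n + 1)) →L[ℝ] EuclideanSpace ℂ (Fin (n + 1)) :=
    fun w ↦ mvfderiv (𝓡 (2 * n + 1)) (fun q ↦ dIncl q (σ q)) w ∘L e.symmL ℝ w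
  have hA : ContMDiffAt (𝓡 (2 * n + 1)) 𝓘(ℝ, EuclideanSpace ℝ (Fin (2 * n + 1)) →L[ℝ]
      EuclideanSpace ℂ (Fin (n + 1))) ∞ A z := by
    refine ((contMDiff_incl n z).mfderiv_const (m := ∞) le_top).congr_of_eventuallyEq ?_
    filter_upwards with w
    ext u
    simp only [inTangentCoordinates, ContinuousLinearMap.inCoordinates, A,
      TangentBundle.continuousLinearMapAt_model_space]
    rfl
  have hP : ContMDiffAt (𝓡 (2 * n + 1)) 𝓘(ℝ, EuclideanSpace ℝ (Fin (2 * n + 1)) →L[ℝ]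
      EuclideanSpace ℂ (Fin (n + 1))) ∞ P z := by
    refine ((hσ' z).mfderiv_const (m := ∞) le_rfl).congr_of_eventuallyEq ?_
    filter_upwards with w
    ext u
    simp only [inTangentCoordinates, ContinuousLinearMap.inCoordinates, P,
      TangentBundle.continuousLinearMapAt_model_space]
    rfl
  have hs : ∀ w (hw : w ∈ e.baseSet) (a : EuclideanSpace ℝ (Fin (2 * n + 1))),
      e.symmL ℝ w a = (e.continuousLinearEquivAt ℝ w hw).symm a := fun w hw a ↦
    congrArg (fun L ↦ L a) (Trivialization.symm_continuousLinearEquivAt_eq e hw).symm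
  have hinj : ∀ w ∈ e.baseSet, Function.Injective (A w) := by
    intro w hw
    refine (dIncl_injective w).comp ?_
    intro a b hab
    exact (e.continuousLinearEquivAt ℝ w hw).symm.injective
      ((hs w hw a).symm.trans (hab.trans (hs w hw b)))
  have hz : z ∈ e.baseSet := FiberBundle.mem_baseSet_trivializationAt' z
  have hN : ContMDiffAt (𝓡 (2 * n + 1)) 𝓘(ℝ, EuclideanSpace ℂ (Fin (n + 1)) →L[ℝ]
      EuclideanSpace ℝ (Fin (2 * n + 1)) →L[ℝ] ℝ) ∞ (fun w ↦ pairL (A w)) z :=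
    contDiff_pairL.contMDiff.contMDiffAt.comp z hA
  have hG : ContMDiffAt (𝓡 (2 * n + 1)) 𝓘(ℝ, EuclideanSpace ℝ (Fin (2 * n + 1)) →L[ℝ]
      EuclideanSpace ℝ (Fin (2 * n + 1)) →L[ℝ] ℝ) ∞ (fun w ↦ pairL (A w) ∘L A w) z :=
    hN.clm_comp hA
  have hGi : ContMDiffAt (𝓡 (2 * n + 1)) 𝓘(ℝ, (EuclideanSpace ℝ (Fin (2 * n + 1)) →L[ℝ] ℝ) →L[ℝ]
      EuclideanSpace ℝ (Fin (2 * n + 1))) ∞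
      (fun w ↦ (pairL (A w) ∘L A w).inverse) z := by
    obtain ⟨e', he'⟩ := pairL_invertible (A z) (hinj z hz)
    have h := contDiffAt_map_inverse (n := ∞) e'
    rw [he'] at h
    exact h.contMDiffAt.comp z hG
  refine (hGi.clm_comp (hN.clm_comp hP)).congr_of_eventuallyEq ?_
  filter_upwards [e.open_baseSet.mem_nhds hz] with w hw
  rw [ContinuousLinearMap.inCoordinates_eq hw hw]
  ext1 u
  symm
  refine (pairL_invertible (A w) (hinj w hw)).inverse_apply_eq.mpr ?_
  ext1 t
  let v := mvfderiv (𝓡 (2 * n + 1)) (fun q ↦ dIncl q (σ q)) w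
    ((e.continuousLinearEquivAt ℝ w hw).symm u)
  have h1 : P w u = v :=
    congrArg (mvfderiv (𝓡 (2 * n + 1)) (fun q ↦ dIncl q (σ q)) w) (hs w hw u)
  have h2 : A w (e.continuousLinearEquivAt ℝ w hw (tanProj w v)) = dIncl w (tanProj w v) :=
    congrArg (dIncl w) ((hs w hw _).trans
      ((e.continuousLinearEquivAt ℝ w hw).symm_apply_apply _))
  have h3 : inner ℝ (A w (e.continuousLinearEquivAt ℝ w hw (tanProj w v))) (A w t) =
      inner ℝ (P w u) (A w t) := by
    rw [h1, h2]
    exact inner_dIncl_tanProj w v _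
  exact h3.symm

theorem leviCivita_isLeviCivita (n : ℕ) : IsLeviCivita (roundMetric n) (leviCivita n) :=
  ⟨leviCivita_contMDiff n, leviCivita_isMetric n, leviCivita_torsion n⟩

end RiemannCartan

open RiemannCartan

/-! Every connection considered is `∇^g + A` on differentiable fields, with `A` a tensor whose first
argument is the differentiated field. A metric `D` with skew torsion has an `A` for which `g(A(u,
v), w)` is a three-form (`isSkewTensor_diffTensor`).

Curvature is computed in `ℂ^(n+1)`. Germs on the sphere are extended to the ambient space, and the
Gauss formula replaces `∇^g` by the flat derivative plus a normal term. The result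
(`IsLeviCivitaPlus.dIncl_curvature`) is the constant curvature part, a part linear in the derivative
of `A`, and a part quadratic in `A`. For skew `A` the derivative of `A` contributes only a two-form
to the Ricci tensor, which leaves (`IsLeviCivitaPlus.symRicci_eq`) `Sym Ric(u, v) = 2n g(u, v) - ∑
g(A(u, e_k), A(v, e_k))`.

Part (i) evaluates this sum for `A = -r η ∧ Φ`. The scalar curvature then follows because `Ric`
enters it only through its symmetric part, with `tr g = 2n + 1` and `|ξ| = 1`.

For part (ii), invariance of `D` makes the three-form at `z` invariant under the stabiliser of `z`.
When `n ≥ 4`, products of two complex reflections that fix `z` already force it to vanish on the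
complex orthogonal complement of `z` (`inner_eq_zero_of_invariant`). Hence the form is `ξ ∧ L` with
`L = A(ξ, ·)`, and `L` itself need not be identified. The Einstein condition says that `Q(x) = ∑
|A(x, e_k)|²` equals `c |x|²` on tangent vectors, while the shape of the form gives `Q(x) = ⟨ξ, x⟩²
|L|² + 2 |L x|²`. Taking `x = ξ` gives `|L|² = c`; taking the trace gives `(2n + 1) c = 3c`. So `c =
0`, then `L = 0` and `A = 0` (`eq_zero_of_invariant_of_einstein`).

Conversely `∇^g` commutes with isometries that are restrictions of linear maps, and `A = 0` gives
`Sym Ric = 2n g`. -/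

namespace RiemannCartan

section

/-! ### Calculus on the sphere through ambient extensions -/

/-- The ambient space `ℂ^(n+1)` of the sphere. -/
abbrev Amb (n : ℕ) : Type := EuclideanSpace ℂ (Fin (n + 1))

/-- The preferred chart at `z` is stereographic projection from `-z`, whose formula makes sense on
an ambient neighbourhood of `z`. -/
theorem exists_ambient_chart {n : ℕ} (z : OddSphere n) :
    ∃ φ : Amb n → EuclideanSpace ℝ (Fin (2 * n + 1)), ContDiffAt ℝ ω φ z ∧
      ∀ q : OddSphere n, φ q = extChartAt (𝓡 (2 * n + 1)) z q := by
  let U : _ ≃ₗᵢ[ℝ] _ :=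
    (OrthonormalBasis.fromOrthogonalSpanSingleton (2 * n + 1)
      (ne_zero_of_mem_unit_sphere (-z))).repr
  refine ⟨fun x ↦ U (stereoToFun ((-z : OddSphere n) : Amb n) x), ?_, fun q ↦ rfl⟩
  refine U.contDiff.contDiffAt.comp _ ((contDiffOn_stereoToFun (n := ω)).contDiffAt ?_)
  have hc : Continuous fun x : Amb n ↦ innerSL ℝ ((-z : OddSphere n) : Amb n) x :=
    (innerSL ℝ _).continuous
  -- Stereographic projection from `-z` is smooth where `⟨-z, x⟩ ≠ 1`; at `x = z` this product is
  -- `-1`.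
  refine (isOpen_ne_fun hc continuous_const).mem_nhds ?_
  have : inner ℝ (z : Amb n) (z : Amb n) = (1 : ℝ) := by
    rw [real_inner_self_eq_norm_sq, norm_eq_of_mem_sphere]; norm_num
  simp only [Set.mem_ofPred_eq, innerSL_apply_apply]
  show inner ℝ (-(z : Amb n)) (z : Amb n) ≠ (1 : ℝ)
  rw [inner_neg_left, this]
  norm_num

variable {F : Type*} [NormedAddCommGroup F] [NormedSpace ℝ F]

/-- Reading `f` in the chart and precomposing with the ambient chart extends the germ without loss
of regularity. Manifold derivatives thereby become Fréchet derivatives in `ℂ^(n+1)`. -/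
theorem exists_ambient_extension {n : ℕ} (f : OddSphere n → F) (z : OddSphere n) :
    ∃ G : Amb n → F, (∀ᶠ q : OddSphere n in nhds z, G q = f q) ∧
      (∀ k : ℕ∞ω, ContMDiffAt (𝓡 (2 * n + 1)) 𝓘(ℝ, F) k f z → ContDiffAt ℝ k G z) ∧
      (MDifferentiableAt (𝓡 (2 * n + 1)) 𝓘(ℝ, F) f z → DifferentiableAt ℝ G z) := by
  obtain ⟨φ, hφ, hφ'⟩ := exists_ambient_chart z
  refine ⟨(f ∘ (extChartAt (𝓡 (2 * n + 1)) z).symm) ∘ φ, ?_, ?_, ?_⟩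
  · filter_upwards [extChartAt_source_mem_nhds (I := 𝓡 (2 * n + 1)) z] with q hq
    simp only [Function.comp_apply, hφ']
    rw [(extChartAt (𝓡 (2 * n + 1)) z).left_inv hq]
  · intro k hf
    have h := (contMDiffAt_iff.mp hf).2
    simp only [ModelWithCorners.range_eq_univ, contDiffWithinAt_univ, ← hφ'] at h
    exact h.comp _ (hφ.of_le le_top)
  · intro hf
    have h := ((mdifferentiableAt_iff ..).mp hf).2
    simp only [ModelWithCorners.range_eq_univ, differentiableWithinAt_univ,
      writtenInExtChartAt, ← hφ'] at h
    exact DifferentiableAt.comp _ h (hφ.differentiableAt (by simp))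

theorem mdifferentiableAt_restrict {n : ℕ} {G : Amb n → F} {z : OddSphere n}
    (hG : DifferentiableAt ℝ G z) :
    MDifferentiableAt (𝓡 (2 * n + 1)) 𝓘(ℝ, F) (fun q : OddSphere n ↦ G q) z :=
  hG.mdifferentiableAt.comp z ((contMDiff_incl n).mdifferentiable (by simp) z)

theorem contMDiffAt_restrict {n : ℕ} {G : Amb n → F} {z : OddSphere n} {k : ℕ∞ω}
    (hG : ContDiffAt ℝ k G z) :
    ContMDiffAt (𝓡 (2 * n + 1)) 𝓘(ℝ, F) k (fun q : OddSphere n ↦ G q) z :=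
  hG.contMDiffAt.comp z ((contMDiff_incl n).of_le le_top z)

theorem mvfderiv_restrict {n : ℕ} {G : Amb n → F} {z : OddSphere n}
    (hG : DifferentiableAt ℝ G z) (u : TS n z) :
    mvfderiv (𝓡 (2 * n + 1)) (fun q : OddSphere n ↦ G q) z u = fderiv ℝ G z (dIncl z u) := by
  have h := mfderiv_comp_apply (I := 𝓡 (2 * n + 1)) (I' := 𝓘(ℝ, Amb n)) (I'' := 𝓘(ℝ, F))
    (g := G) (f := (Subtype.val : OddSphere n → Amb n)) z hG.mdifferentiableAt
    ((contMDiff_incl n).mdifferentiable (by simp) z) u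
  rw [mfderiv_eq_fderiv] at h
  exact h

theorem mvfderiv_congr {n : ℕ} {f g : OddSphere n → F} {z : OddSphere n}
    (h : ∀ᶠ q in nhds z, f q = g q) (u : TS n z) :
    mvfderiv (𝓡 (2 * n + 1)) f z u = mvfderiv (𝓡 (2 * n + 1)) g z u := by
  have h' : f =ᶠ[nhds z] g := h
  unfold mvfderiv
  rw [h'.mfderiv_eq, h'.eq_of_nhds]

theorem mvfderiv_eq_of_extension {n : ℕ} {f : OddSphere n → F} {G : Amb n → F} {z : OddSphere n}
    (h : ∀ᶠ q : OddSphere n in nhds z, G q = f q) (hG : DifferentiableAt ℝ G z) (u : TS n z) :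
    mvfderiv (𝓡 (2 * n + 1)) f z u = fderiv ℝ G z (dIncl z u) := by
  rw [← mvfderiv_restrict hG, mvfderiv_congr h]

/-! ### Smooth vector fields -/

/-- The tangential projection of a constant vector, as a vector field. -/
noncomputable def projField {n : ℕ} (w : Amb n) (q : OddSphere n) : TS n q := tanProj q w

/-- In a trivialisation with frame `A`, the projection of `w` solves the normal equations, so its
coordinates are `(AᵀA)⁻¹ Aᵀ w`, with `pairL A` in the role of `Aᵀ`. Inversion of invertible
operators is smooth. -/
theorem isSmoothField_projField {n : ℕ} (w : Amb n) :
    IsSmoothField (𝓡 (2 * n + 1)) (projField (n := n) w) := by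
  intro z
  let e := trivializationAt (EuclideanSpace ℝ (Fin (2 * n + 1)))
    (TangentSpace (𝓡 (2 * n + 1)) (M := OddSphere n)) z
  let A : OddSphere n → EuclideanSpace ℝ (Fin (2 * n + 1)) →L[ℝ] Amb n :=
    fun q ↦ dIncl q ∘L e.symmL ℝ q
  have hA : ContMDiffAt (𝓡 (2 * n + 1)) 𝓘(ℝ, EuclideanSpace ℝ (Fin (2 * n + 1)) →L[ℝ]
      Amb n) ∞ A z := by
    refine ((contMDiff_incl n z).mfderiv_const (m := ∞) le_top).congr_of_eventuallyEq ?_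
    filter_upwards with w
    ext u
    simp only [inTangentCoordinates, ContinuousLinearMap.inCoordinates, A,
      TangentBundle.continuousLinearMapAt_model_space]
    rfl
  have hs : ∀ q (hq : q ∈ e.baseSet) (a : EuclideanSpace ℝ (Fin (2 * n + 1))),
      e.symmL ℝ q a = (e.continuousLinearEquivAt ℝ q hq).symm a := fun q hq a ↦
    congrArg (fun L ↦ L a) (Trivialization.symm_continuousLinearEquivAt_eq e hq).symm
  have hinj : ∀ q ∈ e.baseSet, Function.Injective (A q) := by
    intro q hq
    refine (dIncl_injective q).comp ?_
    intro a b hab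
    exact (e.continuousLinearEquivAt ℝ q hq).symm.injective
      ((hs q hq a).symm.trans (hab.trans (hs q hq b)))
  have hz : z ∈ e.baseSet := FiberBundle.mem_baseSet_trivializationAt' z
  have hN : ContMDiffAt (𝓡 (2 * n + 1)) 𝓘(ℝ, Amb n →L[ℝ]
      EuclideanSpace ℝ (Fin (2 * n + 1)) →L[ℝ] ℝ) ∞ (fun q ↦ pairL (A q)) z :=
    contDiff_pairL.contMDiff.contMDiffAt.comp z hA
  have hG : ContMDiffAt (𝓡 (2 * n + 1)) 𝓘(ℝ, EuclideanSpace ℝ (Fin (2 * n + 1)) →L[ℝ]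
      EuclideanSpace ℝ (Fin (2 * n + 1)) →L[ℝ] ℝ) ∞ (fun q ↦ pairL (A q) ∘L A q) z :=
    hN.clm_comp hA
  have hGi : ContMDiffAt (𝓡 (2 * n + 1)) 𝓘(ℝ, (EuclideanSpace ℝ (Fin (2 * n + 1)) →L[ℝ] ℝ) →L[ℝ]
      EuclideanSpace ℝ (Fin (2 * n + 1))) ∞
      (fun q ↦ (pairL (A q) ∘L A q).inverse) z := by
    obtain ⟨e', he'⟩ := pairL_invertible (A z) (hinj z hz)
    have h := contDiffAt_map_inverse (n := ∞) e'
    rw [he'] at h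
    exact h.contMDiffAt.comp z hG
  rw [contMDiffAt_section]
  refine (hGi.clm_apply (hN.clm_apply contMDiffAt_const)).congr_of_eventuallyEq
    (f₁ := fun q ↦ (e ⟨q, projField w q⟩).2) (f := fun q ↦ (pairL (A q) ∘L A q).inverse (pairL (A q) w)) ?_
  filter_upwards [e.open_baseSet.mem_nhds hz] with q hq
  symm
  refine (pairL_invertible (A q) (hinj q hq)).inverse_apply_eq.mpr ?_
  ext1 t
  have h2 : A q (e ⟨q, projField w q⟩).2 = dIncl q (tanProj q w) :=
    congrArg (dIncl q) ((hs q hq _).trans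
      ((e.continuousLinearEquivAt ℝ q hq).symm_apply_apply _))
  have h3 : inner ℝ (A q (e ⟨q, projField w q⟩).2) (A q t) = inner ℝ w (A q t) := by
    rw [h2]
    exact inner_dIncl_tanProj q w _
  exact h3.symm

theorem mdifferentiableAt_projField {n : ℕ} (w : Amb n) (z : OddSphere n) :
    MDifferentiableAt (𝓡 (2 * n + 1)) (𝓡 (2 * n + 1)).tangent
      (fun q ↦ TotalSpace.mk' (EuclideanSpace ℝ (Fin (2 * n + 1))) q (projField w q)) z :=
  (isSmoothField_projField w z).mdifferentiableAt (by simp)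

/-- Projections of constant vectors form a global smooth generating family, so the regularity of a
field can be read off its `ℂ^(n+1)`-valued function. -/
theorem eq_sum_projField {n : ℕ} (X : ∀ z : OddSphere n, TS n z) :
    X = fun q ↦ ∑ k, ((fun q ↦ inner ℝ (stdOrthonormalBasis ℝ (Amb n) k) (dIncl q (X q))) •
      projField (stdOrthonormalBasis ℝ (Amb n) k)) q := by
  funext q
  conv_lhs => rw [← tanProj_dIncl q (X q),
    ← (stdOrthonormalBasis ℝ (Amb n)).sum_repr' (dIncl q (X q)), map_sum]
  simp [projField]

theorem mdifferentiableAt_field_of_dIncl {n : ℕ} {X : ∀ z : OddSphere n, TS n z} {z : OddSphere n}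
    (hX : MDifferentiableAt (𝓡 (2 * n + 1)) 𝓘(ℝ, Amb n) (fun w ↦ dIncl w (X w)) z) :
    MDifferentiableAt (𝓡 (2 * n + 1)) (𝓡 (2 * n + 1)).tangent
      (fun w ↦ TotalSpace.mk' (EuclideanSpace ℝ (Fin (2 * n + 1))) w (X w)) z := by
  rw [eq_sum_projField X]
  refine MDifferentiableAt.sum_section fun k _ ↦ MDifferentiableAt.smul_section ?_
    (mdifferentiableAt_projField _ z)
  exact (innerSL ℝ (stdOrthonormalBasis ℝ (Amb n) k)).differentiableAt.mdifferentiableAt.comp z hX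

theorem contMDiffAt_field_of_dIncl {n : ℕ} {X : ∀ z : OddSphere n, TS n z} {z : OddSphere n}
    (hX : ContMDiffAt (𝓡 (2 * n + 1)) 𝓘(ℝ, Amb n) ∞ (fun w ↦ dIncl w (X w)) z) :
    ContMDiffAt (𝓡 (2 * n + 1)) (𝓡 (2 * n + 1)).tangent ∞
      (fun w ↦ TotalSpace.mk' (EuclideanSpace ℝ (Fin (2 * n + 1))) w (X w)) z := by
  rw [eq_sum_projField X]
  refine ContMDiffAt.sum_section fun k _ ↦ ContMDiffAt.smul_section ?_
    (isSmoothField_projField _ z)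
  exact (innerSL ℝ (stdOrthonormalBasis ℝ (Amb n) k)).contDiff.contMDiff.contMDiffAt.comp z hX

end

section

/-! ### The curvature of a connection `∇^g + A` -/

/-- The tensor `A` at `z`, extended to the ambient space by zero on the normal direction. -/
noncomputable def ambTensor {n : ℕ} (A : ∀ z : OddSphere n, TS n z →L[ℝ] TS n z →L[ℝ] TS n z)
    (z : OddSphere n) (w x : Amb n) : Amb n := dIncl z (A z (tanProj z w) (tanProj z x))

/-- `D = ∇^g + A` on differentiable fields. -/
def IsLeviCivitaPlus {n : ℕ} (D : Connection n)
    (A : ∀ z : OddSphere n, TS n z →L[ℝ] TS n z →L[ℝ] TS n z) : Prop :=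
  ∀ (Y : ∀ z : OddSphere n, TS n z) (z : OddSphere n),
    MDifferentiableAt (𝓡 (2 * n + 1)) (𝓡 (2 * n + 1)).tangent
      (fun w ↦ TotalSpace.mk' (EuclideanSpace ℝ (Fin (2 * n + 1))) w (Y w)) z →
    ∀ u : TS n z, D Y z u = leviCivita n Y z u + A z (Y z) u

/-- Near `z` the tensor `A` is the restriction of `β`, which is differentiable at `z`. -/
def IsTensorExtension {n : ℕ} (A : ∀ z : OddSphere n, TS n z →L[ℝ] TS n z →L[ℝ] TS n z)
    (z : OddSphere n) (β : Amb n → Amb n →L[ℝ] Amb n →L[ℝ] Amb n) : Prop :=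
  DifferentiableAt ℝ β z ∧
    ∀ᶠ q : OddSphere n in nhds z, ∀ w x, β q w x = ambTensor A q w x

theorem inner_self_sphere {n : ℕ} (z : OddSphere n) : inner ℝ (z : Amb n) (z : Amb n) = (1 : ℝ) := by
  rw [real_inner_self_eq_norm_sq, norm_eq_of_mem_sphere]; norm_num

theorem tanProj_self {n : ℕ} (z : OddSphere n) : tanProj z (z : Amb n) = 0 := by
  apply dIncl_injective z
  rw [dIncl_tanProj, inner_self_sphere]
  simp

theorem ambTensor_dIncl {n : ℕ} (A : ∀ z : OddSphere n, TS n z →L[ℝ] TS n z →L[ℝ] TS n z)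
    (z : OddSphere n) (u v : TS n z) : ambTensor A z (dIncl z u) (dIncl z v) =
      dIncl z (A z u v) := by
  simp [ambTensor, tanProj_dIncl]

/-- Differentiate `⟨w, Z_w⟩ = 0`; this is the second fundamental form of the sphere. -/
theorem inner_mvfderiv_dIncl {n : ℕ} {Z : ∀ z : OddSphere n, TS n z} {z : OddSphere n}
    (hZ : MDifferentiableAt (𝓡 (2 * n + 1)) 𝓘(ℝ, Amb n) (fun w ↦ dIncl w (Z w)) z) (u : TS n z) :
    inner ℝ (z : Amb n) (mvfderiv (𝓡 (2 * n + 1)) (fun w ↦ dIncl w (Z w)) z u) =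
      -inner ℝ (dIncl z u) (dIncl z (Z z)) := by
  have h := mvfderiv_inner (f := (Subtype.val : OddSphere n → Amb n))
    ((contMDiff_incl n).mdifferentiable (by simp) z) hZ u
  have h0 : (fun w : OddSphere n ↦ (inner ℝ (w : Amb n) (dIncl w (Z w)) : ℝ)) = fun _ ↦ 0 := by
    funext w; exact inner_dIncl w _
  rw [h0, mvfderiv_const] at h
  have h' : (0 : ℝ) = inner ℝ (dIncl z u) (dIncl z (Z z)) +
      inner ℝ (z : Amb n) (mvfderiv (𝓡 (2 * n + 1)) (fun w ↦ dIncl w (Z w)) z u) := h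
  linarith

theorem dIncl_leviCivita {n : ℕ} {Z : ∀ z : OddSphere n, TS n z} {z : OddSphere n}
    (hZ : MDifferentiableAt (𝓡 (2 * n + 1)) 𝓘(ℝ, Amb n) (fun w ↦ dIncl w (Z w)) z) (u : TS n z) :
    dIncl z (leviCivita n Z z u) = mvfderiv (𝓡 (2 * n + 1)) (fun w ↦ dIncl w (Z w)) z u +
      (inner ℝ (dIncl z u) (dIncl z (Z z)) : ℝ) • (z : Amb n) := by
  rw [leviCivita_apply, dIncl_tanProj, inner_mvfderiv_dIncl hZ, neg_smul, sub_neg_eq_add]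

variable {n : ℕ} {D : Connection n} {A : ∀ z : OddSphere n, TS n z →L[ℝ] TS n z →L[ℝ] TS n z}

theorem IsLeviCivitaPlus.dIncl_apply (hD : IsLeviCivitaPlus D A) {Z : ∀ z : OddSphere n, TS n z}
    {z : OddSphere n}
    (hZ : MDifferentiableAt (𝓡 (2 * n + 1)) 𝓘(ℝ, Amb n) (fun w ↦ dIncl w (Z w)) z) (u : TS n z) :
    dIncl z (D Z z u) = mvfderiv (𝓡 (2 * n + 1)) (fun w ↦ dIncl w (Z w)) z u +
      (inner ℝ (dIncl z u) (dIncl z (Z z)) : ℝ) • (z : Amb n) +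
      ambTensor A z (dIncl z (Z z)) (dIncl z u) := by
  rw [hD Z z (mdifferentiableAt_field_of_dIncl hZ) u, map_add, dIncl_leviCivita hZ,
    ambTensor_dIncl]

/-- `q ↦ ∇_Y Z` in terms of ambient extensions. -/
theorem IsLeviCivitaPlus.eventually_eq (hD : IsLeviCivitaPlus D A)
    {Y Z : ∀ z : OddSphere n, TS n z} {p : OddSphere n} {b c : Amb n → Amb n}
    (hb : ∀ᶠ q : OddSphere n in nhds p, b q = dIncl q (Y q))
    (hc : ∀ᶠ q : OddSphere n in nhds p, c q = dIncl q (Z q))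
    (hc2 : ContDiffAt ℝ 2 c p) {β : Amb n → Amb n →L[ℝ] Amb n →L[ℝ] Amb n}
    (hβ : IsTensorExtension A p β) :
    ∀ᶠ q : OddSphere n in nhds p, fderiv ℝ c q (b q) + (inner ℝ (b q) (c q) : ℝ) • (q : Amb n) +
      β q (c q) (b q) = dIncl q (D Z q (Y q)) := by
  have hdiff : ∀ᶠ q : OddSphere n in nhds p, DifferentiableAt ℝ c q := by
    have h : ∀ᶠ x in nhds (p : Amb n), DifferentiableAt ℝ c x :=
      (hc2.eventually (by simp)).mono fun x hx ↦ hx.differentiableAt (by simp)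
    exact continuous_subtype_val.continuousAt.eventually h
  filter_upwards [hb, hc.eventually_nhds, hdiff, hβ.2] with q h1 h2 h3 h4
  have hZ : MDifferentiableAt (𝓡 (2 * n + 1)) 𝓘(ℝ, Amb n) (fun w ↦ dIncl w (Z w)) q :=
    (mdifferentiableAt_restrict h3).congr_of_eventuallyEq (h2.mono fun _ h ↦ h.symm)
  rw [hD.dIncl_apply hZ, mvfderiv_eq_of_extension h2 h3, h4, h1, h2.self_of_nhds]

/-- The ambient expression of `∇_Y Z` is differentiated along `X` and projected. The terms outside
`tanProj` are `A` applied to `∇_Y Z`, those inside come from `∇^g`. -/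
theorem IsLeviCivitaPlus.second_derivative (hD : IsLeviCivitaPlus D A)
    {X Y Z : ∀ z : OddSphere n, TS n z} {p : OddSphere n} {b c : Amb n → Amb n}
    (hb : ∀ᶠ q : OddSphere n in nhds p, b q = dIncl q (Y q))
    (hb1 : DifferentiableAt ℝ b p)
    (hc : ∀ᶠ q : OddSphere n in nhds p, c q = dIncl q (Z q))
    (hc2 : ContDiffAt ℝ 2 c p) {β : Amb n → Amb n →L[ℝ] Amb n →L[ℝ] Amb n}
    (hβ : IsTensorExtension A p β) :
    dIncl p (D (fun q ↦ D Z q (Y q)) p (X p)) =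
      dIncl p (tanProj p (fderiv ℝ (fderiv ℝ c) p (dIncl p (X p)) (dIncl p (Y p)) +
        fderiv ℝ c p (fderiv ℝ b p (dIncl p (X p))) +
        (inner ℝ (dIncl p (Y p)) (dIncl p (Z p)) : ℝ) • dIncl p (X p) +
        (fderiv ℝ β p (dIncl p (X p)) (dIncl p (Z p)) (dIncl p (Y p)) +
          β p (fderiv ℝ c p (dIncl p (X p))) (dIncl p (Y p)) +
          β p (dIncl p (Z p)) (fderiv ℝ b p (dIncl p (X p)))))) +
      (β p (fderiv ℝ c p (dIncl p (Y p))) (dIncl p (X p)) +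
        β p (β p (dIncl p (Z p)) (dIncl p (Y p))) (dIncl p (X p))) := by
  have hb0 := hb.self_of_nhds
  have hc0 := hc.self_of_nhds
  have hβ0 := hβ.2.self_of_nhds
  have hc1 : DifferentiableAt ℝ c p := hc2.differentiableAt (by simp)
  have hc' : DifferentiableAt ℝ (fderiv ℝ c) p :=
    (hc2.fderiv_right (m := 1) (by norm_num)).differentiableAt (by simp)
  have hev := hD.eventually_eq hb hc hc2 hβ
  set u := dIncl p (X p)
  have hG : HasFDerivAt (fun q : Amb n ↦ fderiv ℝ c q (b q) + (inner ℝ (b q) (c q) : ℝ) • q +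
      β q (c q) (b q)) _ (p : Amb n) :=
    ((hc'.hasFDerivAt.clm_apply hb1.hasFDerivAt).add
      ((hb1.hasFDerivAt.inner ℝ hc1.hasFDerivAt).smul (hasFDerivAt_id _))).add
      ((hβ.1.hasFDerivAt.clm_apply hc1.hasFDerivAt).clm_apply hb1.hasFDerivAt)
  have hW : MDifferentiableAt (𝓡 (2 * n + 1)) 𝓘(ℝ, Amb n)
      (fun w ↦ dIncl w ((fun q ↦ D Z q (Y q)) w)) p :=
    (mdifferentiableAt_restrict hG.differentiableAt).congr_of_eventuallyEq
      (hev.mono fun _ h ↦ h.symm)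
  -- The normal part of the Gauss formula for `∇_Y Z` is a multiple of `p`, which `β p` annihilates.
  have hzero : β p p = 0 := by
    ext1 x
    rw [hβ0, ambTensor, tanProj_self]
    simp
  rw [hD _ _ (mdifferentiableAt_field_of_dIncl hW), map_add, leviCivita_apply,
    mvfderiv_eq_of_extension hev hG.differentiableAt, hG.fderiv, ← ambTensor_dIncl,
    ← hβ0, ← hev.self_of_nhds]
  have e1 : β p (fderiv ℝ c p (b p) + (inner ℝ (b p) (c p) : ℝ) • (p : Amb n) +
      β p (c p) (b p)) u = β p (fderiv ℝ c p (dIncl p (Y p))) u +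
        β p (β p (dIncl p (Z p)) (dIncl p (Y p))) u := by
    rw [map_add, map_add, map_smul, hzero, hb0, hc0]
    simp
  rw [e1]
  congr 2
  simp only [add_apply, ContinuousLinearMap.comp_apply,
    ContinuousLinearMap.flip_apply, smul_apply,
    ContinuousLinearMap.smulRight_apply, map_add, map_smul, hb0, hc0]
  -- The derivative of the scalar `⟨Y, Z⟩` multiplies `p` and is lost under the projection.
  simp only [smul_zero, ContinuousLinearMap.coe_id', id_eq, u, tanProj_self]
  abel

/-- The curvature of `∇^g + A` in terms of an ambient extension of `A`. -/
theorem IsLeviCivitaPlus.dIncl_curvatureField (hD : IsLeviCivitaPlus D A) {p : OddSphere n}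
    {β : Amb n → Amb n →L[ℝ] Amb n →L[ℝ] Amb n} (hβ : IsTensorExtension A p β)
    {X Y Z : ∀ z : OddSphere n, TS n z}
    (hX : ContMDiffAt (𝓡 (2 * n + 1)) (𝓡 (2 * n + 1)).tangent 2
      (fun q ↦ TotalSpace.mk' (EuclideanSpace ℝ (Fin (2 * n + 1))) q (X q)) p)
    (hY : ContMDiffAt (𝓡 (2 * n + 1)) (𝓡 (2 * n + 1)).tangent 2
      (fun q ↦ TotalSpace.mk' (EuclideanSpace ℝ (Fin (2 * n + 1))) q (Y q)) p)
    (hZ : ContMDiffAt (𝓡 (2 * n + 1)) (𝓡 (2 * n + 1)).tangent 2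
      (fun q ↦ TotalSpace.mk' (EuclideanSpace ℝ (Fin (2 * n + 1))) q (Z q)) p) :
    dIncl p (curvatureField D X Y Z p) =
      (inner ℝ (dIncl p (Y p)) (dIncl p (Z p)) : ℝ) • dIncl p (X p) -
        (inner ℝ (dIncl p (X p)) (dIncl p (Z p)) : ℝ) • dIncl p (Y p) +
      dIncl p (tanProj p (fderiv ℝ β p (dIncl p (X p)) (dIncl p (Z p)) (dIncl p (Y p)) -
        fderiv ℝ β p (dIncl p (Y p)) (dIncl p (Z p)) (dIncl p (X p)))) +
      (β p (β p (dIncl p (Z p)) (dIncl p (Y p))) (dIncl p (X p)) -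
        β p (β p (dIncl p (Z p)) (dIncl p (X p))) (dIncl p (Y p))) := by
  obtain ⟨a, ha, ha', -⟩ := exists_ambient_extension (fun q ↦ dIncl q (X q)) p
  obtain ⟨b, hb, hb', -⟩ := exists_ambient_extension (fun q ↦ dIncl q (Y q)) p
  obtain ⟨c, hc, hc', -⟩ := exists_ambient_extension (fun q ↦ dIncl q (Z q)) p
  have ha2 := ha' _ (contMDiffAt_dIncl_field hX)
  have hb2 := hb' _ (contMDiffAt_dIncl_field hY)
  have hc2 := hc' _ (contMDiffAt_dIncl_field hZ)
  have ha1 := ha2.differentiableAt (by simp)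
  have hb1 := hb2.differentiableAt (by simp)
  have hc1 := hc2.differentiableAt (by simp)
  have hβ0 := hβ.2.self_of_nhds
  have hbr : dIncl p (mlieBracket (𝓡 (2 * n + 1)) X Y p) =
      fderiv ℝ b p (dIncl p (X p)) - fderiv ℝ a p (dIncl p (Y p)) := by
    rw [dIncl_mlieBracket (hX.mdifferentiableAt (by simp)) (hY.mdifferentiableAt (by simp)),
      mvfderiv_eq_of_extension hb hb1, mvfderiv_eq_of_extension ha ha1]
  have h1 := hD.second_derivative (X := X) hb hb1 hc hc2 hβ
  have h2 := hD.second_derivative (X := Y) ha ha1 hc hc2 hβ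
  have h3 : dIncl p (D Z p (mlieBracket (𝓡 (2 * n + 1)) X Y p)) =
      dIncl p (tanProj p (fderiv ℝ c p
        (fderiv ℝ b p (dIncl p (X p)) - fderiv ℝ a p (dIncl p (Y p))))) +
      β p (dIncl p (Z p)) (fderiv ℝ b p (dIncl p (X p)) - fderiv ℝ a p (dIncl p (Y p))) := by
    rw [hD Z p (hZ.mdifferentiableAt (by simp)), map_add, leviCivita_apply,
      mvfderiv_eq_of_extension hc hc1, hβ0, ← hbr, ambTensor_dIncl]
  have hT : ∀ x y, dIncl p (tanProj p (β p x y)) = β p x y := by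
    intro x y
    rw [hβ0, ambTensor, tanProj_dIncl]
  -- The second derivatives of `Z` cancel by symmetry, and the first derivatives of `X` and `Y`
  -- cancel against the bracket term, so only tensorial terms survive.
  have hsymm : fderiv ℝ (fderiv ℝ c) p (dIncl p (X p)) (dIncl p (Y p)) =
      fderiv ℝ (fderiv ℝ c) p (dIncl p (Y p)) (dIncl p (X p)) :=
    (hc2.isSymmSndFDerivAt (by simp)).eq _ _
  have hdef : dIncl p (curvatureField D X Y Z p) = dIncl p (D (fun q ↦ D Z q (Y q)) p (X p)) -
      dIncl p (D (fun q ↦ D Z q (X q)) p (Y p)) -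
      dIncl p (D Z p (mlieBracket (𝓡 (2 * n + 1)) X Y p)) := by
    rw [← map_sub, ← map_sub]
    rfl
  rw [hdef, h1, h2, h3]
  simp only [map_add, map_sub, map_smul, hT, tanProj_dIncl, hsymm]
  abel

theorem IsLeviCivitaPlus.dIncl_curvature (hD : IsLeviCivitaPlus D A) {p : OddSphere n}
    {β : Amb n → Amb n →L[ℝ] Amb n →L[ℝ] Amb n} (hβ : IsTensorExtension A p β)
    (u v w : TS n p) :
    dIncl p (curvature D p u v w) =
      (inner ℝ (dIncl p v) (dIncl p w) : ℝ) • dIncl p u -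
        (inner ℝ (dIncl p u) (dIncl p w) : ℝ) • dIncl p v +
      dIncl p (tanProj p (fderiv ℝ β p (dIncl p u) (dIncl p w) (dIncl p v) -
        fderiv ℝ β p (dIncl p v) (dIncl p w) (dIncl p u))) +
      (β p (β p (dIncl p w) (dIncl p v)) (dIncl p u) -
        β p (β p (dIncl p w) (dIncl p u)) (dIncl p v)) := by
  have h := hD.dIncl_curvatureField hβ (FiberBundle.contMDiffAt_extend _ _ u)
    (FiberBundle.contMDiffAt_extend _ _ v) (FiberBundle.contMDiffAt_extend _ _ w)
  rwa [FiberBundle.extend_apply_self, FiberBundle.extend_apply_self,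
    FiberBundle.extend_apply_self] at h

end

section

/-! ### The Ricci tensor of a connection `∇^g + A` with totally skew `A` -/

/-- `(u, v, w) ↦ g(A(u, v), w)` is alternating at `z`. -/
def IsSkewTensor {n : ℕ} (A : ∀ z : OddSphere n, TS n z →L[ℝ] TS n z →L[ℝ] TS n z)
    (z : OddSphere n) : Prop :=
  ∀ u v w : TS n z, roundInner z (A z u v) w = -roundInner z (A z v u) w ∧
    roundInner z (A z u v) w = -roundInner z (A z u w) v

theorem inner_dIncl_left {n : ℕ} (z : OddSphere n) (u : TS n z) (x : Amb n) :
    inner ℝ (dIncl z u) (dIncl z (tanProj z x)) = (inner ℝ (dIncl z u) x : ℝ) := by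
  rw [real_inner_comm, inner_dIncl_tanProj, real_inner_comm]

theorem inner_dIncl_tanProj_comm {n : ℕ} (z : OddSphere n) (x y : Amb n) :
    inner ℝ (dIncl z (tanProj z x)) y = (inner ℝ x (dIncl z (tanProj z y)) : ℝ) := by
  rw [← inner_dIncl_left, inner_dIncl_tanProj]

variable {n : ℕ} {D : Connection n} {A : ∀ z : OddSphere n, TS n z →L[ℝ] TS n z →L[ℝ] TS n z}

theorem inner_ambTensor (A : ∀ z : OddSphere n, TS n z →L[ℝ] TS n z →L[ℝ] TS n z)
    (z : OddSphere n) (w x y : Amb n) : inner ℝ (ambTensor A z w x) y =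
      roundInner z (A z (tanProj z w) (tanProj z x)) (tanProj z y) := by
  rw [roundInner_apply, inner_dIncl_left]; rfl

theorem IsSkewTensor.amb_swap {z : OddSphere n} (hA : IsSkewTensor A z) (w x y : Amb n) :
    (inner ℝ (ambTensor A z w x) y : ℝ) = -inner ℝ (ambTensor A z x w) y := by
  rw [inner_ambTensor, inner_ambTensor]; exact (hA _ _ _).1

theorem IsSkewTensor.amb_swap' {z : OddSphere n} (hA : IsSkewTensor A z) (w x y : Amb n) :
    (inner ℝ (ambTensor A z w x) y : ℝ) = -inner ℝ (ambTensor A z w y) x := by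
  rw [inner_ambTensor, inner_ambTensor]; exact (hA _ _ _).2

theorem IsSkewTensor.amb_cycle {z : OddSphere n} (hA : IsSkewTensor A z) (w x y : Amb n) :
    (inner ℝ (ambTensor A z w x) y : ℝ) = inner ℝ (ambTensor A z x y) w := by
  rw [hA.amb_swap, hA.amb_swap', neg_neg]

/-- Since `tanProj` is a left inverse of `dIncl`, cyclicity gives `tr L = tr (dIncl ∘ L ∘ tanProj)`.
Traces can thus be taken over an orthonormal basis of `ℂ^(n+1)` that need not be adapted to `p`. -/
theorem sum_coord_eq_sum_inner {ι : Type*} [Fintype ι] (e : OrthonormalBasis ι ℝ (Amb n))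
    (p : OddSphere n) (L : TS n p →ₗ[ℝ] TS n p) :
    ∑ i, (tangentBasis (𝓡 (2 * n + 1)) p).coord i (L (tangentBasis (𝓡 (2 * n + 1)) p i)) =
      ∑ k, inner ℝ (e k) (dIncl p (L (tanProj p (e k)))) := by
  classical
  have : FiniteDimensional ℝ (TS n p) :=
    inferInstanceAs (FiniteDimensional ℝ (EuclideanSpace ℝ (Fin (2 * n + 1))))
  have h1 : LinearMap.trace ℝ (TS n p) L =
      ∑ i, (tangentBasis (𝓡 (2 * n + 1)) p).coord i (L (tangentBasis (𝓡 (2 * n + 1)) p i)) := by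
    rw [LinearMap.trace_eq_matrix_trace ℝ (tangentBasis (𝓡 (2 * n + 1)) p) L]
    simp [Matrix.trace, LinearMap.toMatrix_apply]
  have h2 : LinearMap.trace ℝ (TS n p) L = LinearMap.trace ℝ (Amb n)
      ((dIncl p).toLinearMap ∘ₗ L ∘ₗ (tanProj p).toLinearMap) := by
    rw [← LinearMap.trace_comp_comm' (dIncl p).toLinearMap]
    congr 1
    ext x
    simp [tanProj_dIncl]
  rw [← h1, h2, LinearMap.trace_eq_sum_inner _ e]
  rfl

/-- The extension `β` has the symmetries of `A` on the sphere only. They still pass to its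
derivative in tangential directions, once the arguments are constant ambient vectors. -/
theorem IsTensorExtension.inner_fderiv_eq_neg {p : OddSphere n}
    {β : Amb n → Amb n →L[ℝ] Amb n →L[ℝ] Amb n} (hβ : IsTensorExtension A p β)
    {w x y w' x' y' : Amb n}
    (h : ∀ q : OddSphere n, (inner ℝ (ambTensor A q w x) y : ℝ) =
      -inner ℝ (ambTensor A q w' x') y') (u : TS n p) :
    (inner ℝ (fderiv ℝ β p (dIncl p u) w x) y : ℝ) =
      -inner ℝ (fderiv ℝ β p (dIncl p u) w' x') y' := by
  have hd : ∀ w x y : Amb n, HasFDerivAt (fun q ↦ (inner ℝ (β q w x) y : ℝ)) _ (p : Amb n) :=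
    fun w x y ↦ ((hβ.1.hasFDerivAt.clm_apply (hasFDerivAt_const w _)).clm_apply
      (hasFDerivAt_const x _)).inner ℝ (hasFDerivAt_const y _)
  have h1 := mvfderiv_restrict (z := p) (hd w x y).differentiableAt u
  have h2 := mvfderiv_restrict (z := p) (hd w' x' y').differentiableAt.neg u
  have h3 := mvfderiv_congr (z := p) (f := fun q : OddSphere n ↦ (inner ℝ (β q w x) y : ℝ))
    (g := fun q : OddSphere n ↦ -(inner ℝ (β q w' x') y' : ℝ))
    (hβ.2.mono fun q hq ↦ by rw [hq, hq]; exact h q) u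
  have h4 := (h1.symm.trans h3).trans h2
  rw [(hd w x y).fderiv, fderiv_neg, (hd w' x' y').fderiv] at h4
  simpa [fderivInnerCLM_apply] using h4

/-- This is the trace of the tangential projection: the ambient dimension `2n + 2` minus `|p|² = 1`.
-/
theorem sum_inner_tanProj {ι : Type*} [Fintype ι] (e : OrthonormalBasis ι ℝ (Amb n))
    (p : OddSphere n) : ∑ k, (inner ℝ (e k) (dIncl p (tanProj p (e k))) : ℝ) = 2 * n + 1 := by
  have h1 : ∀ k, (inner ℝ (e k) (dIncl p (tanProj p (e k))) : ℝ) =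
      1 - inner ℝ (p : Amb n) (e k) * inner ℝ (e k) (p : Amb n) := by
    intro k
    rw [dIncl_tanProj, inner_sub_right, inner_smul_right, real_inner_self_eq_norm_sq,
      e.norm_eq_one]
    simp
  have h2 : (Fintype.card ι : ℝ) = 2 * n + 2 := by
    have h := (Module.finrank_eq_card_basis e.toBasis).symm.trans (finrankFact n).out
    rw [h]; push_cast; ring
  rw [Finset.sum_congr rfl fun k _ ↦ h1 k, Finset.sum_sub_distrib, e.sum_inner_mul_inner,
    inner_self_sphere]
  simp [h2]
  ring

variable {ι : Type*} [Fintype ι] (e : OrthonormalBasis ι ℝ (Amb n))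

/-- The right-hand side of the curvature formula, as a linear map in the first argument. -/
noncomputable def curvatureMap {V : Type*} [NormedAddCommGroup V] [InnerProductSpace ℝ V]
    (T : V →L[ℝ] V) (N : V →L[ℝ] V →L[ℝ] V →L[ℝ] V) (B : V →L[ℝ] V →L[ℝ] V) (v w : V) :
    V →ₗ[ℝ] V where
  toFun x := (inner ℝ v w : ℝ) • x - (inner ℝ x w : ℝ) • v + T (N x w v - N v w x) +
    (B (B w v) x - B (B w x) v)
  map_add' x y := by
    have h : N (x + y) = N x + N y := N.map_add x y
    simp only [h, T.map_add, T.map_sub, (N v w).map_add, (B _).map_add, B.map_add,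
      inner_add_left, add_apply]
    module
  map_smul' c x := by
    have h : N (c • x) = c • N x := N.map_smul c x
    simp only [h, T.map_smul, T.map_sub, (N v w).map_smul, (B _).map_smul,
      B.map_smul, inner_smul_left, smul_apply, RCLike.conj_to_real, RingHom.id_apply]
    module

/-- `curvature` is defined through extensions of vectors, so its linearity in the first slot, needed
to speak of a trace, is read off the explicit formula. -/
theorem IsLeviCivitaPlus.exists_curvature_eq (hD : IsLeviCivitaPlus D A) {p : OddSphere n}
    {β : Amb n → Amb n →L[ℝ] Amb n →L[ℝ] Amb n} (hβ : IsTensorExtension A p β) (u v : TS n p) :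
    ∃ L : TS n p →ₗ[ℝ] TS n p, ∀ x, L x = curvature D p x u v := by
  refine ⟨(tanProj p).toLinearMap ∘ₗ curvatureMap (dIncl p ∘L tanProj p) (fderiv ℝ β p) (β p)
    (dIncl p u) (dIncl p v) ∘ₗ (dIncl p).toLinearMap, fun x ↦ ?_⟩
  rw [← tanProj_dIncl p (curvature D p x u v), hD.dIncl_curvature hβ]
  rfl

theorem IsLeviCivitaPlus.inner_curvature (hD : IsLeviCivitaPlus D A) {p : OddSphere n}
    {β : Amb n → Amb n →L[ℝ] Amb n →L[ℝ] Amb n} (hβ : IsTensorExtension A p β)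
    (hA : ∀ q, IsSkewTensor A q) (u v : TS n p) (x : Amb n) :
    (inner ℝ x (dIncl p (curvature D p (tanProj p x) u v)) : ℝ) =
      inner ℝ (dIncl p u) (dIncl p v) * inner ℝ x (dIncl p (tanProj p x)) -
      inner ℝ (dIncl p u) x * inner ℝ x (dIncl p v) +
      inner ℝ (fderiv ℝ β p (dIncl p (tanProj p x)) (dIncl p v) (dIncl p u))
        (dIncl p (tanProj p x)) -
      inner ℝ (ambTensor A p (dIncl p u) x) (ambTensor A p (dIncl p v) x) := by
  have hβ0 := hβ.2.self_of_nhds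
  -- Skewness in the last two slots kills every term in which `x` fills both (`e2`, `e4`); cyclicity
  -- turns the other quadratic term into a scalar product (`e5`).
  have e2 : (inner ℝ (fderiv ℝ β p (dIncl p u) (dIncl p v) (dIncl p (tanProj p x)))
      (dIncl p (tanProj p x)) : ℝ) = 0 :=
    self_eq_neg.mp (hβ.inner_fderiv_eq_neg (fun q ↦ (hA q).amb_swap' _ _ _) u)
  have e3 : ∀ y, ambTensor A p y (dIncl p (tanProj p x)) = ambTensor A p y x := by
    intro y
    rw [ambTensor, tanProj_dIncl]; rfl
  have e4 : (inner ℝ x (ambTensor A p (ambTensor A p (dIncl p v) (dIncl p u)) x) : ℝ) = 0 := by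
    rw [real_inner_comm]
    exact self_eq_neg.mp ((hA p).amb_swap' _ _ _)
  have e5 : (inner ℝ x (ambTensor A p (ambTensor A p (dIncl p v) x) (dIncl p u)) : ℝ)
      = inner ℝ (ambTensor A p (dIncl p u) x) (ambTensor A p (dIncl p v) x) := by
    rw [real_inner_comm, (hA p).amb_cycle]
  have e6 : ∀ y, (inner ℝ x (dIncl p (tanProj p y)) : ℝ) = inner ℝ y (dIncl p (tanProj p x)) := by
    intro y
    rw [real_inner_comm, inner_dIncl_tanProj_comm]
  rw [hD.dIncl_curvature hβ, hβ0, hβ0, hβ0, hβ0, e3, e3]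
  generalize fderiv ℝ β p (dIncl p u) (dIncl p v) (dIncl p (tanProj p x)) = N₁ at *
  generalize fderiv ℝ β p (dIncl p (tanProj p x)) (dIncl p v) (dIncl p u) = N₂ at *
  rw [inner_add_right, inner_add_right, inner_sub_right x (_ • _), inner_smul_right,
    inner_smul_right, e6 (N₂ - N₁), inner_sub_left, e2, inner_sub_right, e4, e5,
    inner_dIncl_tanProj, real_inner_comm (dIncl p u) x]
  ring

/-- Summing the sectional terms, the constant curvature part contributes `(2n + 1) - 1 = 2n`, and
the middle sum is a divergence of `A`. -/
theorem IsLeviCivitaPlus.ricci_eq (hD : IsLeviCivitaPlus D A) {p : OddSphere n}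
    {β : Amb n → Amb n →L[ℝ] Amb n →L[ℝ] Amb n} (hβ : IsTensorExtension A p β)
    (hA : ∀ q, IsSkewTensor A q) (u v : TS n p) :
    ricci D p u v = 2 * n * roundInner p u v +
      ∑ k, inner ℝ (fderiv ℝ β p (dIncl p (tanProj p (e k))) (dIncl p v) (dIncl p u))
        (dIncl p (tanProj p (e k))) -
      ∑ k, inner ℝ (ambTensor A p (dIncl p u) (e k)) (ambTensor A p (dIncl p v) (e k)) := by
  obtain ⟨L, hL⟩ := hD.exists_curvature_eq hβ u v
  have h1 : ricci D p u v = ∑ k, inner ℝ (e k) (dIncl p (L (tanProj p (e k)))) := by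
    rw [← sum_coord_eq_sum_inner]
    simp only [hL]
    rfl
  rw [h1]
  simp only [hL]
  rw [Finset.sum_congr rfl fun k _ ↦ hD.inner_curvature hβ hA u v (e k), Finset.sum_sub_distrib,
    Finset.sum_add_distrib, Finset.sum_sub_distrib, ← Finset.mul_sum, sum_inner_tanProj,
    e.sum_inner_mul_inner, roundInner_apply]
  ring

/-- The symmetric part of the Ricci tensor of a metric connection with skew torsion. -/
theorem IsLeviCivitaPlus.symRicci_eq (hD : IsLeviCivitaPlus D A) {p : OddSphere n}
    {β : Amb n → Amb n →L[ℝ] Amb n →L[ℝ] Amb n} (hβ : IsTensorExtension A p β)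
    (hA : ∀ q, IsSkewTensor A q) (u v : TS n p) :
    symRicci D p u v = 2 * n * roundInner p u v -
      ∑ k, inner ℝ (ambTensor A p (dIncl p u) (e k)) (ambTensor A p (dIncl p v) (e k)) := by
  rw [symRicci, hD.ricci_eq e hβ hA, hD.ricci_eq e hβ hA, roundInner_symm p v u]
  -- The divergence term is skew in `u, v` and disappears on symmetrising.
  have h1 : ∀ k, (inner ℝ (fderiv ℝ β p (dIncl p (tanProj p (e k))) (dIncl p u) (dIncl p v))
      (dIncl p (tanProj p (e k))) : ℝ) =
      -inner ℝ (fderiv ℝ β p (dIncl p (tanProj p (e k))) (dIncl p v) (dIncl p u))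
        (dIncl p (tanProj p (e k))) := fun k ↦
    hβ.inner_fderiv_eq_neg (fun q ↦ (hA q).amb_swap _ _ _) _
  rw [Finset.sum_congr rfl fun k _ ↦ h1 k, Finset.sum_neg_distrib,
    Finset.sum_congr rfl fun k _ ↦ real_inner_comm (ambTensor A p (dIncl p u) (e k))
      (ambTensor A p (dIncl p v) (e k))]
  ring

/-! ### The scalar curvature -/

/-- With `G` the Gram matrix of the chosen basis, the trace of `g` is `tr (G⁻¹ G)` and the trace of
`η ⊗ η` is `|ξ|²`. -/
theorem scalarCurvature_of_symRicci {D : Connection n} {p : OddSphere n} {a b : ℝ}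
    (h : ∀ u v, symRicci D p u v = a * roundInner p u v + b * (eta p u * eta p v)) :
    scalarCurvature (roundMetric n) D p = a * (2 * n + 1) + b * roundInner p (reeb p) (reeb p) := by
  classical
  let B := tangentBasis (𝓡 (2 * n + 1)) p
  let G : Matrix (Fin (finrank ℝ (EuclideanSpace ℝ (Fin (2 * n + 1)))))
    (Fin (finrank ℝ (EuclideanSpace ℝ (Fin (2 * n + 1))))) ℝ :=
    Matrix.of fun k l ↦ roundInner p (B k) (B l)
  have hGs : G.transpose = G := by
    ext i j
    exact roundInner_symm p _ _
  have hGi : G⁻¹.transpose = G⁻¹ := by rw [Matrix.transpose_nonsing_inv, hGs]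
  have hGv : ∀ x : TS n p, G.mulVec (B.repr x) = fun i ↦ roundInner p x (B i) := by
    intro x
    ext i
    conv_rhs => rw [← B.sum_repr x]
    simp only [Matrix.mulVec, dotProduct, G, Matrix.of_apply, map_sum, map_smul,
      sum_apply, smul_apply, smul_eq_mul]
    exact Finset.sum_congr rfl fun j _ ↦ by rw [roundInner_symm, mul_comm]
  have hunit : IsUnit G := by
    rw [← Matrix.mulVec_injective_iff_isUnit]
    intro x y hxy
    have hz : G.mulVec (x - y) = 0 := by rw [Matrix.mulVec_sub, sub_eq_zero]; exact hxy
    set s := ∑ i, (x - y) i • B i with hs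
    have hrep : ⇑(B.repr s) = x - y := by
      rw [hs]; exact B.repr_sum_self (x - y)
    have h0 : roundInner p s s = 0 := by
      have h1 := hGv s
      rw [hrep, hz] at h1
      conv_lhs => enter [2]; rw [← B.sum_repr s]
      simp only [map_sum, map_smul, smul_eq_mul]
      refine Finset.sum_eq_zero fun i _ ↦ ?_
      have h2 : (0 : ℝ) = roundInner p s (B i) := congrFun h1 i
      rw [← h2, mul_zero]
    have hs0 : s = 0 := by
      apply dIncl_injective p
      rw [map_zero]
      exact inner_self_eq_zero.mp h0
    rw [hs0] at hrep
    have : x - y = 0 := by rw [← hrep]; simp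
    exact sub_eq_zero.mp this
  have hdet : IsUnit G.det := (Matrix.isUnit_iff_isUnit_det G).mp hunit
  have hsc : scalarCurvature (roundMetric n) D p =
      ∑ i, ∑ j, G⁻¹ i j * ricci D p (B i) (B j) := rfl
  -- `G⁻¹` is symmetric, so the skew part of the Ricci tensor has zero trace.
  have hsym : scalarCurvature (roundMetric n) D p =
      ∑ i, ∑ j, G⁻¹ i j * symRicci D p (B i) (B j) := by
    have h2 : ∑ i, ∑ j, G⁻¹ i j * ricci D p (B i) (B j) =
        ∑ i, ∑ j, G⁻¹ i j * ricci D p (B j) (B i) := by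
      rw [Finset.sum_comm]
      refine Finset.sum_congr rfl fun i _ ↦ Finset.sum_congr rfl fun j _ ↦ ?_
      rw [← congrFun (congrFun hGi i) j, Matrix.transpose_apply]
    have h3 : ∑ i, ∑ j, G⁻¹ i j * symRicci D p (B i) (B j) =
        (∑ i, ∑ j, G⁻¹ i j * ricci D p (B i) (B j) +
          ∑ i, ∑ j, G⁻¹ i j * ricci D p (B j) (B i)) / 2 := by
      simp only [symRicci, ← Finset.sum_add_distrib, Finset.sum_div]
      refine Finset.sum_congr rfl fun i _ ↦ Finset.sum_congr rfl fun j _ ↦ ?_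
      ring
    rw [h3, ← h2, hsc]; ring
  have htr : ∑ i, ∑ j, G⁻¹ i j * roundInner p (B i) (B j) = 2 * n + 1 := by
    have h1 : ∑ i, ∑ j, G⁻¹ i j * roundInner p (B i) (B j) = (G⁻¹ * G).trace := by
      simp only [Matrix.trace, Matrix.diag_apply, Matrix.mul_apply]
      refine Finset.sum_congr rfl fun i _ ↦ Finset.sum_congr rfl fun j _ ↦ ?_
      rw [roundInner_symm]; rfl
    rw [h1, Matrix.nonsing_inv_mul _ hdet, Matrix.trace_one, Fintype.card_fin,
      finrank_euclideanSpace_fin]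
    push_cast; ring
  -- The components of `η` are `G` times the coordinates of `ξ`, so `G⁻¹` returns these coordinates
  -- and the sum is `η(ξ)`.
  have heta : ∑ i, ∑ j, G⁻¹ i j * (eta p (B i) * eta p (B j)) =
      roundInner p (reeb p) (reeb p) := by
    have h1 : (fun i ↦ eta p (B i)) = G.mulVec (B.repr (reeb p)) := (hGv (reeb p)).symm
    have h2 : ∑ i, ∑ j, G⁻¹ i j * (eta p (B i) * eta p (B j)) =
        ∑ i, eta p (B i) * (G⁻¹.mulVec fun i ↦ eta p (B i)) i := by
      simp only [Matrix.mulVec, dotProduct, Finset.mul_sum]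
      refine Finset.sum_congr rfl fun i _ ↦ Finset.sum_congr rfl fun j _ ↦ ?_
      ring
    rw [h2, h1, Matrix.mulVec_mulVec, Matrix.nonsing_inv_mul _ hdet, Matrix.one_mulVec]
    conv_rhs => enter [2]; rw [← B.sum_repr (reeb p)]
    simp only [map_sum, map_smul, smul_eq_mul]
    exact Finset.sum_congr rfl fun i _ ↦ mul_comm _ _
  have hsplit : ∑ i, ∑ j, G⁻¹ i j * symRicci D p (B i) (B j) =
      a * (∑ i, ∑ j, G⁻¹ i j * roundInner p (B i) (B j)) +
        b * ∑ i, ∑ j, G⁻¹ i j * (eta p (B i) * eta p (B j)) := by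
    simp only [h, Finset.mul_sum, ← Finset.sum_add_distrib]
    refine Finset.sum_congr rfl fun i _ ↦ Finset.sum_congr rfl fun j _ ↦ ?_
    ring
  rw [hsym, hsplit, htr, heta]

end

section

/-! ### The connections `∇^g + r (Φ ⊗ ξ - η ⊗ ψ + ψ ⊗ η)` -/

variable {n : ℕ} {A : ∀ z : OddSphere n, TS n z →L[ℝ] TS n z →L[ℝ] TS n z}

/-! ### Ambient extensions of tensors with differentiable components. -/

theorem ambTensor_eq_sum {ι : Type*} [Fintype ι] (e : OrthonormalBasis ι ℝ (Amb n))
    (A : ∀ z : OddSphere n, TS n z →L[ℝ] TS n z →L[ℝ] TS n z)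
    (z : OddSphere n) (w x : Amb n) : ambTensor A z w x =
      ∑ k, ∑ l, (inner ℝ (e k) w : ℝ) • (inner ℝ (e l) x : ℝ) • ambTensor A z (e k) (e l) := by
  unfold ambTensor
  conv_lhs => rw [← e.sum_repr' w, ← e.sum_repr' x]
  simp only [map_sum, map_smul, sum_apply, smul_apply, Finset.smul_sum]
  rw [Finset.sum_comm]
  exact Finset.sum_congr rfl fun k _ ↦ Finset.sum_congr rfl fun l _ ↦ smul_comm _ _ _

/-- `v ↦ ((w, x) ↦ a(w) b(x) v)`. -/
noncomputable def tensorCLM {V : Type*} [NormedAddCommGroup V] [NormedSpace ℝ V] (a b : V →L[ℝ] ℝ) :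
    V →L[ℝ] V →L[ℝ] V →L[ℝ] V :=
  (ContinuousLinearMap.smulRightL ℝ V (V →L[ℝ] V) a) ∘L
    (ContinuousLinearMap.smulRightL ℝ V V b)

theorem exists_differentiableAt_sum {W V H ι : Type*} [NormedAddCommGroup W] [NormedSpace ℝ W]
    [NormedAddCommGroup V] [NormedSpace ℝ V] [NormedAddCommGroup H] [NormedSpace ℝ H] [Fintype ι]
    (Λ : ι → ι → V →L[ℝ] H) {f : ι → ι → W → V} {x : W}
    (hf : ∀ k l, DifferentiableAt ℝ (f k l) x) :
    ∃ β : W → H, DifferentiableAt ℝ β x ∧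
      ∀ (φ : H →L[ℝ] V) (y : W), φ (β y) = ∑ k, ∑ l, φ (Λ k l (f k l y)) :=
  ⟨fun y ↦ ∑ k, ∑ l, Λ k l (f k l y), DifferentiableAt.fun_sum fun k _ ↦
    DifferentiableAt.fun_sum fun l _ ↦ (Λ k l).differentiableAt.comp x (hf k l), fun φ y ↦ by
    simp only [map_sum]⟩

set_option synthInstance.maxHeartbeats 200000 in
theorem exists_differentiableAt_bilinear {W V ι : Type*} [NormedAddCommGroup W] [NormedSpace ℝ W]
    [NormedAddCommGroup V] [NormedSpace ℝ V] [Fintype ι] (a b : ι → V →L[ℝ] ℝ)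
    {f : ι → ι → W → V} {x : W} (hf : ∀ k l, DifferentiableAt ℝ (f k l) x) :
    ∃ β : W → V →L[ℝ] V →L[ℝ] V, DifferentiableAt ℝ β x ∧
      ∀ y v w, β y v w = ∑ k, ∑ l, a k v • b l w • f k l y := by
  obtain ⟨β, h1, h2⟩ := exists_differentiableAt_sum (H := V →L[ℝ] V →L[ℝ] V)
    (fun k l ↦ tensorCLM (a k) (b l)) hf
  exact ⟨β, h1, fun y v w ↦ h2 (ContinuousLinearMap.apply ℝ V w ∘L
    ContinuousLinearMap.apply ℝ (V →L[ℝ] V) v) y⟩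

/-- A tensor with differentiable components has a differentiable ambient extension. -/
theorem exists_isTensorExtension {p : OddSphere n}
    (h : ∀ w x : Amb n, MDifferentiableAt (𝓡 (2 * n + 1)) 𝓘(ℝ, Amb n)
      (fun q ↦ ambTensor A q w x) p) :
    ∃ β, IsTensorExtension A p β := by
  let e := stdOrthonormalBasis ℝ (Amb n)
  choose F hF using fun k l ↦ exists_ambient_extension (fun q ↦ ambTensor A q (e k) (e l)) p
  obtain ⟨β, hβ1, hβ2⟩ := exists_differentiableAt_bilinear (fun k ↦ innerSL ℝ (e k))
    (fun k ↦ innerSL ℝ (e k)) fun k l ↦ (hF k l).2.2 (h _ _)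
  have hall : ∀ᶠ q : OddSphere n in nhds p, ∀ k l, F k l q = ambTensor A q (e k) (e l) :=
    Filter.eventually_all.mpr fun k ↦ Filter.eventually_all.mpr fun l ↦ (hF k l).1
  refine ⟨β, hβ1, ?_⟩
  filter_upwards [hall] with q hq w x
  rw [ambTensor_eq_sum e, hβ2]
  simp only [hq]
  rfl

/-! ### Multiplication by `i` and the tensor `η ∧ Φ` in ambient terms. -/

theorem inner_I_smul_left (x y : Amb n) :
    (inner ℝ (Complex.I • x) y : ℝ) = -inner ℝ x (Complex.I • y) := by
  have h : ∀ a b : Amb n, (inner ℝ a b : ℝ) = (inner ℂ a b : ℂ).re := fun a b ↦ by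
    simp [PiLp.inner_apply]
  rw [h, h, inner_smul_left, inner_smul_right]
  simp

theorem inner_I_smul_I_smul (x y : Amb n) :
    (inner ℝ (Complex.I • x) (Complex.I • y) : ℝ) = inner ℝ x y := by
  rw [inner_I_smul_left, smul_smul, Complex.I_mul_I, neg_one_smul, inner_neg_right, neg_neg]

theorem inner_I_smul_self (x : Amb n) : (inner ℝ x (Complex.I • x) : ℝ) = 0 := by
  have h := inner_I_smul_left x x
  rw [real_inner_comm] at h
  exact self_eq_neg.mp h

theorem I_smul_real_smul (a : ℝ) (x : Amb n) : Complex.I • (a • x) = a • (Complex.I • x) :=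
  smul_comm _ _ _

theorem dIncl_reeb (z : OddSphere n) : dIncl z (reeb z) = -(Complex.I • (z : Amb n)) := by
  rw [reeb, dIncl_tanProj, inner_neg_right, inner_I_smul_self]
  simp

theorem eta_apply (z : OddSphere n) (u : TS n z) :
    eta z u = -inner ℝ (Complex.I • (z : Amb n)) (dIncl z u) := by
  rw [eta, roundInner_apply, dIncl_reeb, inner_neg_left]

theorem dIncl_psi (z : OddSphere n) (u : TS n z) : dIncl z (psi z u) =
    Complex.I • dIncl z u - (inner ℝ (z : Amb n) (Complex.I • dIncl z u) : ℝ) • (z : Amb n) :=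
  dIncl_tanProj z _

theorem fundForm_apply (z : OddSphere n) (u v : TS n z) :
    fundForm z u v = inner ℝ (dIncl z u) (Complex.I • dIncl z v) := by
  rw [fundForm, roundInner_apply, dIncl_psi, inner_sub_right, inner_smul_right,
    real_inner_comm (z : Amb n) (dIncl z u), inner_dIncl, mul_zero, sub_zero]

theorem roundInner_reeb (z : OddSphere n) : roundInner z (reeb z) (reeb z) = 1 := by
  rw [roundInner_apply, dIncl_reeb, inner_neg_neg, inner_I_smul_I_smul, inner_self_sphere]

/-- All normal corrections cancel, for arbitrary ambient `w` and `x`. The result is linear in `z`,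
so it extends to `ℂ^(n+1)` at once. -/
theorem ambTensor_skewForm (r : ℝ) (z : OddSphere n) (w x : Amb n) :
    ambTensor (skewForm r) z w x = r • (-(inner ℝ x (Complex.I • w) : ℝ) • Complex.I • (z : Amb n) +
      (inner ℝ x (Complex.I • (z : Amb n)) : ℝ) • Complex.I • w -
      (inner ℝ w (Complex.I • (z : Amb n)) : ℝ) • Complex.I • x) := by
  have hz := inner_I_smul_self (z : Amb n)
  have h1 := inner_self_sphere z
  rw [ambTensor, skewForm_apply]
  simp only [map_smul, map_add, map_sub, fundForm_apply, eta_apply, dIncl_reeb, dIncl_psi,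
    dIncl_tanProj, smul_sub, I_smul_real_smul, inner_sub_left, inner_sub_right, inner_smul_left,
    inner_smul_right, hz, inner_I_smul_left, RCLike.conj_to_real, neg_zero, mul_zero, sub_zero]
  have h2 : ∀ y, (inner ℝ (z : Amb n) (Complex.I • y) : ℝ) = -inner ℝ y (Complex.I • (z : Amb n)) := by
    intro y
    rw [real_inner_comm, inner_I_smul_left]
  rw [h2 w, h2 x]
  module

/-- Lowering the index gives `-r` times the cyclic sum of `η ⊗ Φ`, which is alternating because `Φ`
is. -/
theorem isSkewTensor_skewForm (r : ℝ) (z : OddSphere n) : IsSkewTensor (skewForm r) z := by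
  intro u v w
  have h : ∀ a b : Amb n, (inner ℝ a (Complex.I • b) : ℝ) = -inner ℝ b (Complex.I • a) := by
    intro a b
    rw [real_inner_comm, inner_I_smul_left]
  have key : ∀ u v w : TS n z, roundInner z (skewForm r z u v) w =
      r * (-inner ℝ (dIncl z v) (Complex.I • dIncl z u) *
          -inner ℝ (z : Amb n) (Complex.I • dIncl z w) +
        -inner ℝ (z : Amb n) (Complex.I • dIncl z v) *
          -inner ℝ (dIncl z u) (Complex.I • dIncl z w) -
        -inner ℝ (z : Amb n) (Complex.I • dIncl z u) *
          -inner ℝ (dIncl z v) (Complex.I • dIncl z w)) := by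
    intro u v w
    rw [roundInner_apply, ← ambTensor_dIncl, ambTensor_skewForm]
    simp only [inner_smul_left, inner_add_left, inner_sub_left, inner_I_smul_left,
      RCLike.conj_to_real]
    rw [h (dIncl z v) (z : Amb n), h (dIncl z u) (z : Amb n)]
  rw [key, key, key]
  constructor
  · rw [h (dIncl z v) (dIncl z u)]; ring
  · rw [h (dIncl z v) (dIncl z u), h (dIncl z w) (dIncl z u), h (dIncl z w) (dIncl z v)]; ring

theorem exists_isTensorExtension_skewForm (r : ℝ) (z : OddSphere n) :
    ∃ β, IsTensorExtension (skewForm (n := n) r) z β := by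
  refine exists_isTensorExtension fun w x ↦ ?_
  simp only [ambTensor_skewForm]
  let J : Amb n →L[ℝ] Amb n := ContinuousLinearMap.lsmul ℝ ℂ Complex.I
  let g : Amb n → Amb n →L[ℝ] ℝ := fun a ↦ innerSL ℝ a ∘L J
  let L : Amb n →L[ℝ] Amb n := r • (-(inner ℝ x (Complex.I • w) : ℝ) • J +
    (g x).smulRight (Complex.I • w) - (g w).smulRight (Complex.I • x))
  exact mdifferentiableAt_restrict (G := L) L.differentiableAt

theorem sum_inner_ambTensor_skewForm {ι : Type*} [Fintype ι] (e : OrthonormalBasis ι ℝ (Amb n))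
    (r : ℝ) (z : OddSphere n) (u v : TS n z) :
    ∑ k, (inner ℝ (ambTensor (skewForm r) z (dIncl z u) (e k))
      (ambTensor (skewForm r) z (dIncl z v) (e k)) : ℝ) =
      2 * r ^ 2 * roundInner z u v + 2 * ((n : ℝ) - 1) * r ^ 2 * (eta z u * eta z v) := by
  set U := dIncl z u
  set V := dIncl z v
  have hc : ∀ a b : Amb n, (inner ℝ a b : ℝ) = inner ℝ b a := fun a b ↦ real_inner_comm b a
  have hzI := inner_I_smul_self (z : Amb n)
  have hzz := inner_self_sphere z
  have hU : (inner ℝ U (z : Amb n) : ℝ) = 0 := by rw [hc]; exact inner_dIncl z u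
  have hV : (inner ℝ (z : Amb n) V : ℝ) = 0 := inner_dIncl z v
  have hk : ∀ k, (inner ℝ (ambTensor (skewForm r) z U (e k))
      (ambTensor (skewForm r) z V (e k)) : ℝ) = r ^ 2 * (
        inner ℝ (Complex.I • U) (e k) * inner ℝ (e k) (Complex.I • V) +
        inner ℝ (Complex.I • V) (z : Amb n) *
          (inner ℝ (Complex.I • U) (e k) * inner ℝ (e k) (z : Amb n)) * (-1) +
        inner ℝ U V * (inner ℝ (Complex.I • (z : Amb n)) (e k) *
          inner ℝ (e k) (Complex.I • (z : Amb n))) -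
        inner ℝ (Complex.I • V) (z : Amb n) * (inner ℝ (Complex.I • (z : Amb n)) (e k) *
          inner ℝ (e k) U) * (-1) -
        inner ℝ (Complex.I • U) (z : Amb n) * (inner ℝ (z : Amb n) (e k) *
          inner ℝ (e k) (Complex.I • V)) -
        inner ℝ (Complex.I • U) (z : Amb n) * (inner ℝ (Complex.I • (z : Amb n)) (e k) *
          inner ℝ (e k) V) * (-1) +
        inner ℝ (Complex.I • U) (z : Amb n) * inner ℝ (Complex.I • V) (z : Amb n)) := by
    intro k
    have hek : (inner ℝ (e k) (e k) : ℝ) = 1 := by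
      rw [real_inner_self_eq_norm_sq, e.norm_eq_one]; norm_num
    rw [ambTensor_skewForm, ambTensor_skewForm]
    simp only [inner_add_left, inner_sub_left, inner_add_right, inner_sub_right, inner_smul_left,
      inner_smul_right, inner_I_smul_I_smul, RCLike.conj_to_real, hU, hV, hzz, hek]
    rw [inner_I_smul_left U (z : Amb n), inner_I_smul_left V (z : Amb n),
      hc (Complex.I • U) (e k), hc (Complex.I • (z : Amb n)) (e k), hc (z : Amb n) (e k), hc U (e k)]
    ring
  have hcard : (Fintype.card ι : ℝ) = 2 * n + 2 := by
    have h := (Module.finrank_eq_card_basis e.toBasis).symm.trans (finrankFact n).out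
    rw [h]; push_cast; ring
  have hs : ∀ a b : Amb n, ∑ k, (inner ℝ a (e k) * inner ℝ (e k) b : ℝ) = inner ℝ a b :=
    fun a b ↦ e.sum_inner_mul_inner a b
  rw [Finset.sum_congr rfl fun k _ ↦ hk k, ← Finset.mul_sum]
  -- By Parseval, the coefficient `2n - 2` of `η ⊗ η` is `2n + 2` from the summand independent of
  -- `k`, minus one for each of four mixed terms.
  simp only [Finset.sum_add_distrib, Finset.sum_sub_distrib, ← Finset.mul_sum, ← Finset.sum_mul,
    hs, Finset.sum_const, Finset.card_univ, nsmul_eq_mul, hcard, inner_I_smul_I_smul, hzz]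
  rw [roundInner_apply, eta_apply, eta_apply, hc (z : Amb n) (Complex.I • V),
    inner_I_smul_left (z : Amb n), inner_I_smul_left (z : Amb n), hc (z : Amb n) (Complex.I • U),
    hc (z : Amb n) (Complex.I • V)]
  ring

theorem isLeviCivitaPlus_skewConnection (r : ℝ) :
    IsLeviCivitaPlus (skewConnection n r) (skewForm r) := fun _ _ _ _ ↦ rfl

theorem symRicci_skewConnection (r : ℝ) (z : OddSphere n) (u v : TS n z) :
    symRicci (skewConnection n r) z u v = 2 * ((n : ℝ) - r ^ 2) * roundInner z u v +
      (-2 * ((n : ℝ) - 1) * r ^ 2) * (eta z u * eta z v) := by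
  obtain ⟨β, hβ⟩ := exists_isTensorExtension_skewForm (n := n) r z
  rw [(isLeviCivitaPlus_skewConnection r).symRicci_eq (stdOrthonormalBasis ℝ (Amb n)) hβ
    (isSkewTensor_skewForm r), sum_inner_ambTensor_skewForm]
  ring

theorem scalarCurvature_skewConnection (r : ℝ) (z : OddSphere n) :
    scalarCurvature (roundMetric n) (skewConnection n r) z =
      2 * (n : ℝ) * (2 * (n : ℝ) + 1) - 6 * (n : ℝ) * r ^ 2 := by
  rw [scalarCurvature_of_symRicci (symRicci_skewConnection r z), roundInner_reeb]
  ring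

end

section

/-! ### The difference of a connection and the Levi-Civita connection -/

variable {n : ℕ}

/-- The difference tensor of `D` and the Levi-Civita connection. -/
noncomputable def diffTensor (D : Connection n) (z : OddSphere n) :
    TS n z →L[ℝ] TS n z →L[ℝ] TS n z :=
  D.difference (leviCivita n) z

theorem isLeviCivitaPlus_diffTensor (D : Connection n) : IsLeviCivitaPlus D (diffTensor D) := by
  intro Y z hY u
  have h : diffTensor D z (Y z) = D Y z - leviCivita n Y z :=
    IsCovariantDerivativeOn.difference_apply D.isCovariantDerivativeOnUniv
      (leviCivita n).isCovariantDerivativeOnUniv (x := z) trivial hY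
  rw [h, sub_apply]
  abel

theorem projField_dIncl (z : OddSphere n) (u : TS n z) : projField (dIncl z u) z = u :=
  tanProj_dIncl z u

theorem ambTensor_diffTensor (D : Connection n) (q : OddSphere n) (w x : Amb n) :
    ambTensor (diffTensor D) q w x = dIncl q (D (projField w) q (projField x q)) -
      dIncl q (leviCivita n (projField w) q (projField x q)) := by
  rw [isLeviCivitaPlus_diffTensor D _ q (mdifferentiableAt_projField w q), map_add]
  simp [ambTensor, projField]

theorem contMDiff_dIncl_connection {D : Connection n} (hD : D.ContMDiffCovariantDerivative ∞)
    (w x : Amb n) (p : OddSphere n) :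
    ContMDiffAt (𝓡 (2 * n + 1)) 𝓘(ℝ, Amb n) ∞
      (fun q ↦ dIncl q (D (projField w) q (projField x q))) p := by
  have h1 := (hD.contMDiff.contMDiff (σ := projField w)
    ((isSmoothField_projField w).contMDiffOn)).contMDiffAt (x := p) Filter.univ_mem
  exact contMDiffAt_dIncl_field (h1.clm_bundle_apply (isSmoothField_projField x p))

theorem exists_isTensorExtension_diffTensor {D : Connection n}
    (hD : D.ContMDiffCovariantDerivative ∞) (p : OddSphere n) :
    ∃ β, IsTensorExtension (diffTensor D) p β := by
  refine exists_isTensorExtension fun w x ↦ ?_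
  simp only [ambTensor_diffTensor]
  exact ((contMDiff_dIncl_connection hD w x p).mdifferentiableAt (by simp)).sub
    ((contMDiff_dIncl_connection (leviCivita_contMDiff n) w x p).mdifferentiableAt (by simp))

/-- Subtract the metric identities of `D` and `∇^g`: their left-hand sides agree. -/
theorem IsMetric.roundInner_diffTensor {D : Connection n} (hD : IsMetric (roundMetric n) D)
    (z : OddSphere n) (u v w : TS n z) : roundInner z (diffTensor D z v u) w =
      -roundInner z (diffTensor D z w u) v := by
  have h1 := hD (projField (dIncl z u)) (projField (dIncl z v)) (projField (dIncl z w))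
    (isSmoothField_projField _) (isSmoothField_projField _) (isSmoothField_projField _) z
  have h2 := leviCivita_isMetric n (projField (dIncl z u)) (projField (dIncl z v))
    (projField (dIncl z w))
    (isSmoothField_projField _) (isSmoothField_projField _) (isSmoothField_projField _) z
  rw [isLeviCivitaPlus_diffTensor D _ z (mdifferentiableAt_projField _ z),
    isLeviCivitaPlus_diffTensor D _ z (mdifferentiableAt_projField _ z)] at h1
  have h3 := h1.symm.trans h2
  simp only [projField_dIncl, map_add, add_apply] at h3
  have h4 : (roundMetric n).inner z = roundInner z := rfl
  rw [h4] at h3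
  rw [roundInner_symm z (diffTensor D z w u) v]
  linarith

theorem torsion_eq_diffTensor (D : Connection n) (z : OddSphere n) (u v : TS n z) :
    D.torsion z u v = diffTensor D z v u - diffTensor D z u v := by
  have h1 := D.torsion_apply (mdifferentiableAt_projField (dIncl z u) z)
    (mdifferentiableAt_projField (dIncl z v) z)
  have h2 := (leviCivita n).torsion_apply (mdifferentiableAt_projField (dIncl z u) z)
    (mdifferentiableAt_projField (dIncl z v) z)
  rw [leviCivita_torsion] at h2
  rw [isLeviCivitaPlus_diffTensor D _ z (mdifferentiableAt_projField _ z),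
    isLeviCivitaPlus_diffTensor D _ z (mdifferentiableAt_projField _ z)] at h1
  simp only [projField_dIncl] at h1 h2
  rw [h1]
  have h3 : (0 : TS n z) = leviCivita n (projField (dIncl z v)) z u -
    leviCivita n (projField (dIncl z u)) z v - mlieBracket (𝓡 (2 * n + 1))
      (projField (dIncl z u)) (projField (dIncl z v)) z := h2
  have h4 : ∀ a b c d e : TS n z, a + b - (c + d) - e = a - c - e + (b - d) := by
    intros; abel
  exact (h4 _ _ _ _ _).trans (by rw [← h3, zero_add])

/-- Metricity is skewness in slots one and three. It removes two of the four terms of the torsion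
condition, leaving skewness in slots two and three; these transpositions generate all permutations.
-/
theorem isSkewTensor_diffTensor {D : Connection n} (hD : IsMetric (roundMetric n) D)
    (hT : HasSkewTorsion (roundMetric n) D) (z : OddSphere n) : IsSkewTensor (diffTensor D) z := by
  have h1 := hD.roundInner_diffTensor z
  have h2 : ∀ u v w, roundInner z (diffTensor D z v u) w - roundInner z (diffTensor D z u v) w =
      -(roundInner z (diffTensor D z w u) v - roundInner z (diffTensor D z u w) v) := by
    intro u v w
    have h := (hT z u v w).2
    have h4 : (roundMetric n).inner z = roundInner z := rfl
    rw [h4, torsion_eq_diffTensor, torsion_eq_diffTensor, map_sub, map_sub] at h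
    exact h
  have h3 : ∀ u v w, roundInner z (diffTensor D z u v) w = -roundInner z (diffTensor D z u w) v := by
    intro u v w
    linarith [h1 u v w, h2 u v w]
  intro u v w
  refine ⟨?_, h3 u v w⟩
  rw [h3 u v w, h1 w u v, h3 v w u, neg_neg]

/-! ### The action of the special unitary group -/

/-- The linear action of `SU(n+1)` on the ambient space. -/
noncomputable def suLin (σ : Matrix.specialUnitaryGroup (Fin (n + 1)) ℂ) : Amb n →L[ℝ] Amb n :=
  (Matrix.toEuclideanCLM (n := Fin (n + 1)) (𝕜 := ℂ) σ.1).restrictScalars ℝ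

theorem coe_suAct (σ : Matrix.specialUnitaryGroup (Fin (n + 1)) ℂ) (z : OddSphere n) :
    (suAct σ z : Amb n) = suLin σ z := rfl

theorem suLin_mul_apply (σ τ : Matrix.specialUnitaryGroup (Fin (n + 1)) ℂ) (x : Amb n) :
    suLin (σ * τ) x = suLin σ (suLin τ x) := by
  have h : Matrix.toEuclideanCLM (n := Fin (n + 1)) (𝕜 := ℂ) (σ * τ).1 =
      Matrix.toEuclideanCLM (n := Fin (n + 1)) (𝕜 := ℂ) σ.1 *
        Matrix.toEuclideanCLM (n := Fin (n + 1)) (𝕜 := ℂ) τ.1 := map_mul _ _ _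
  exact congrArg (fun L ↦ L x) h

theorem suLin_one_apply (x : Amb n) :
    suLin (1 : Matrix.specialUnitaryGroup (Fin (n + 1)) ℂ) x = x := by
  have h : Matrix.toEuclideanCLM (n := Fin (n + 1)) (𝕜 := ℂ)
      (1 : Matrix.specialUnitaryGroup (Fin (n + 1)) ℂ).1 = 1 := map_one _
  exact congrArg (fun L ↦ L x) h

theorem suLin_inv_apply (σ : Matrix.specialUnitaryGroup (Fin (n + 1)) ℂ) (x : Amb n) :
    suLin σ (suLin σ⁻¹ x) = x := by
  rw [← suLin_mul_apply, mul_inv_cancel, suLin_one_apply]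

theorem suLin_inv_apply' (σ : Matrix.specialUnitaryGroup (Fin (n + 1)) ℂ) (x : Amb n) :
    suLin σ⁻¹ (suLin σ x) = x := by
  rw [← suLin_mul_apply, inv_mul_cancel, suLin_one_apply]

theorem inner_suLin (σ : Matrix.specialUnitaryGroup (Fin (n + 1)) ℂ) (x y : Amb n) :
    (inner ℝ (suLin σ x) (suLin σ y) : ℝ) = inner ℝ x y := by
  have hU : Matrix.toEuclideanCLM (n := Fin (n + 1)) (𝕜 := ℂ) σ.1 ∈
      unitary (Amb n →L[ℂ] Amb n) :=
    Unitary.map_mem _ (Matrix.mem_specialUnitaryGroup_iff.mp σ.2).1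
  have hn : ∀ x, ‖suLin σ x‖ = ‖x‖ := fun x ↦ ContinuousLinearMap.norm_map_of_mem_unitary hU x
  rw [real_inner_eq_norm_add_mul_self_sub_norm_mul_self_sub_norm_mul_self_div_two, ← map_add,
    hn, hn, hn, ← real_inner_eq_norm_add_mul_self_sub_norm_mul_self_sub_norm_mul_self_div_two]

theorem contMDiff_suAct (σ : Matrix.specialUnitaryGroup (Fin (n + 1)) ℂ) :
    ContMDiff (𝓡 (2 * n + 1)) (𝓡 (2 * n + 1)) ∞ (suAct (n := n) σ) := by
  have h : ContMDiff (𝓡 (2 * n + 1)) 𝓘(ℝ, Amb n) ∞ (fun z : OddSphere n ↦ suLin σ z) :=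
    fun z ↦ contMDiffAt_restrict (suLin σ).contDiff.contDiffAt
  exact h.codRestrict_sphere (fun z ↦ (suAct σ z).2)

theorem mdifferentiableAt_suAct (σ : Matrix.specialUnitaryGroup (Fin (n + 1)) ℂ)
    (z : OddSphere n) :
    MDifferentiableAt (𝓡 (2 * n + 1)) (𝓡 (2 * n + 1)) (suAct (n := n) σ) z :=
  (contMDiff_suAct σ z).mdifferentiableAt (by simp)

theorem dIncl_mfderiv_suAct (σ : Matrix.specialUnitaryGroup (Fin (n + 1)) ℂ) (z : OddSphere n)
    (u : TS n z) :
    dIncl (suAct σ z) (mfderiv (𝓡 (2 * n + 1)) (𝓡 (2 * n + 1)) (suAct σ) z u) =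
      suLin σ (dIncl z u) := by
  have h1 := mvfderiv_restrict (z := z) (suLin (n := n) σ).differentiableAt u
  rw [ContinuousLinearMap.fderiv] at h1
  rw [← h1]
  have h2 := mfderiv_comp_apply (I := 𝓡 (2 * n + 1)) (I' := 𝓡 (2 * n + 1))
    (I'' := 𝓘(ℝ, Amb n)) (g := (Subtype.val : OddSphere n → Amb n)) (f := suAct σ) z
    ((contMDiff_incl n).mdifferentiable (by simp) _) (mdifferentiableAt_suAct σ z) u
  exact h2.symm

theorem isInvertible_mfderiv_suAct (σ : Matrix.specialUnitaryGroup (Fin (n + 1)) ℂ)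
    (z : OddSphere n) :
    (mfderiv (𝓡 (2 * n + 1)) (𝓡 (2 * n + 1)) (suAct (n := n) σ) z).IsInvertible := by
  have h : Function.Injective (mfderiv (𝓡 (2 * n + 1)) (𝓡 (2 * n + 1)) (suAct (n := n) σ) z) := by
    intro u v huv
    apply dIncl_injective z
    have h := congrArg (fun t ↦ suLin σ⁻¹ (dIncl (suAct σ z) t)) huv
    simpa only [dIncl_mfderiv_suAct, suLin_inv_apply'] using h
  exact isInvertible_of_injective (A := EuclideanSpace ℝ (Fin (2 * n + 1)))
    (B := EuclideanSpace ℝ (Fin (2 * n + 1))) _ h rfl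

theorem mfderiv_pushforward (σ : Matrix.specialUnitaryGroup (Fin (n + 1)) ℂ)
    (X : ∀ z : OddSphere n, TS n z) (z : OddSphere n) :
    mfderiv (𝓡 (2 * n + 1)) (𝓡 (2 * n + 1)) (suAct σ⁻¹) z (pushforward σ X z) =
      X (suAct σ⁻¹ z) :=
  apply_inverse (isInvertible_mfderiv_suAct σ⁻¹ z) _

theorem dIncl_pushforward (σ : Matrix.specialUnitaryGroup (Fin (n + 1)) ℂ)
    (X : ∀ z : OddSphere n, TS n z) (z : OddSphere n) :
    dIncl z (pushforward σ X z) = suLin σ (dIncl (suAct σ⁻¹ z) (X (suAct σ⁻¹ z))) := by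
  rw [← mfderiv_pushforward σ X z, dIncl_mfderiv_suAct, suLin_inv_apply]

theorem isSmoothField_pushforward (σ : Matrix.specialUnitaryGroup (Fin (n + 1)) ℂ)
    {X : ∀ z : OddSphere n, TS n z} (hX : IsSmoothField (𝓡 (2 * n + 1)) X) :
    IsSmoothField (𝓡 (2 * n + 1)) (pushforward σ X) := by
  intro z
  apply contMDiffAt_field_of_dIncl
  simp only [dIncl_pushforward]
  have h1 : ContMDiffAt (𝓡 (2 * n + 1)) 𝓘(ℝ, Amb n) ∞
      ((fun q ↦ dIncl q (X q)) ∘ suAct σ⁻¹) z :=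
    (contMDiffAt_dIncl_field (hX _)).comp z (contMDiff_suAct σ⁻¹ z)
  exact (suLin σ).contDiff.contMDiff.contMDiffAt.comp z h1

/-- The action is the restriction of a linear isometry, which commutes with the flat derivative and
preserves the normal term of the Gauss formula. -/
theorem leviCivita_pushforward (σ : Matrix.specialUnitaryGroup (Fin (n + 1)) ℂ)
    {X Y : ∀ z : OddSphere n, TS n z} (hY : IsSmoothField (𝓡 (2 * n + 1)) Y) (z : OddSphere n) :
    pushforward σ (fun z ↦ leviCivita n Y z (X z)) z =
      leviCivita n (pushforward σ Y) z (pushforward σ X z) := by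
  have hd : ∀ {Y : ∀ z : OddSphere n, TS n z}, IsSmoothField (𝓡 (2 * n + 1)) Y → ∀ z,
      MDifferentiableAt (𝓡 (2 * n + 1)) 𝓘(ℝ, Amb n) (fun w ↦ dIncl w (Y w)) z := fun hY z ↦
    mdifferentiableAt_dIncl_field ((hY z).mdifferentiableAt (by simp))
  apply dIncl_injective z
  rw [dIncl_pushforward, dIncl_leviCivita (hd hY _),
    dIncl_leviCivita (hd (isSmoothField_pushforward σ hY) z)]
  have h1 : (fun w ↦ dIncl w (pushforward σ Y w)) =
      suLin σ ∘ ((fun q ↦ dIncl q (Y q)) ∘ suAct σ⁻¹) := by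
    funext w
    exact dIncl_pushforward σ Y w
  have h2 : MDifferentiableAt (𝓡 (2 * n + 1)) 𝓘(ℝ, Amb n)
      ((fun q ↦ dIncl q (Y q)) ∘ suAct σ⁻¹) z :=
    (hd hY _).comp z (mdifferentiableAt_suAct σ⁻¹ z)
  have h3 := mfderiv_comp_apply (I := 𝓡 (2 * n + 1)) (I' := 𝓘(ℝ, Amb n)) (I'' := 𝓘(ℝ, Amb n))
    (g := suLin σ) (f := (fun q ↦ dIncl q (Y q)) ∘ suAct σ⁻¹) z
    (suLin σ).differentiableAt.mdifferentiableAt h2 (pushforward σ X z)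
  have h4 := mfderiv_comp_apply (I := 𝓡 (2 * n + 1)) (I' := 𝓡 (2 * n + 1)) (I'' := 𝓘(ℝ, Amb n))
    (g := fun q ↦ dIncl q (Y q)) (f := suAct σ⁻¹) z (hd hY _) (mdifferentiableAt_suAct σ⁻¹ z)
    (pushforward σ X z)
  rw [mfderiv_pushforward] at h4
  rw [h4, mfderiv_eq_fderiv, ContinuousLinearMap.fderiv] at h3
  have h5 : mvfderiv (𝓡 (2 * n + 1)) (fun w ↦ dIncl w (pushforward σ Y w)) z
      (pushforward σ X z) = suLin σ (mvfderiv (𝓡 (2 * n + 1)) (fun q ↦ dIncl q (Y q))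
        (suAct σ⁻¹ z) (X (suAct σ⁻¹ z))) := by
    rw [h1]
    exact h3
  rw [h5, dIncl_pushforward, dIncl_pushforward, inner_suLin, map_add, map_smul]
  congr 2
  rw [coe_suAct, suLin_inv_apply]

theorem leviCivita_isSUInvariant (n : ℕ) : IsSUInvariant (leviCivita n) := by
  intro σ X Y _ hY
  funext z
  exact leviCivita_pushforward σ hY z

theorem ambTensor_add_smul_self (A : ∀ z : OddSphere n, TS n z →L[ℝ] TS n z →L[ℝ] TS n z)
    (z : OddSphere n) (w x : Amb n) (a b : ℝ) :
    ambTensor A z (w - a • (z : Amb n)) (x - b • (z : Amb n)) = ambTensor A z w x := by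
  simp [ambTensor, tanProj_self]

/-- The difference of two invariant connections is an invariant tensor. It is tested on pushforwards
of projected constant fields, which at `z` differ from `σ w` and `σ x` by normal vectors only. -/
theorem IsSUInvariant.ambTensor_suLin {D : Connection n} (hD : IsSUInvariant D)
    (σ : Matrix.specialUnitaryGroup (Fin (n + 1)) ℂ) (z : OddSphere n) (w x : Amb n) :
    ambTensor (diffTensor D) z (suLin σ w) (suLin σ x) =
      suLin σ (ambTensor (diffTensor D) (suAct σ⁻¹ z) w x) := by
  have h1 := congrFun (hD σ (projField x) (projField w) (isSmoothField_projField x)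
    (isSmoothField_projField w)) z
  have h2 := leviCivita_pushforward σ (X := projField x) (isSmoothField_projField w) z
  have h3 := isLeviCivitaPlus_diffTensor D (pushforward σ (projField w)) z
    ((isSmoothField_pushforward σ (isSmoothField_projField w) z).mdifferentiableAt (by simp))
    (pushforward σ (projField x) z)
  have h4 : ∀ y : Amb n, dIncl z (pushforward σ (projField y) z) =
      suLin σ y - (inner ℝ (suAct σ⁻¹ z : Amb n) y : ℝ) • (z : Amb n) := by
    intro y
    rw [dIncl_pushforward, projField, dIncl_tanProj, map_sub, map_smul, coe_suAct,
      suLin_inv_apply]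
  rw [ambTensor_diffTensor D (suAct σ⁻¹ z), map_sub,
    ← dIncl_pushforward σ (fun q ↦ D (projField w) q (projField x q)),
    ← dIncl_pushforward σ (fun q ↦ leviCivita n (projField w) q (projField x q)), h1, h2, h3,
    map_add, add_sub_cancel_left, ← ambTensor_dIncl, h4, h4, ambTensor_add_smul_self]

end

section

/-! ### Products of two complex reflections -/

variable {n : ℕ}

/-- The matrix of the reflection `x ↦ x - 2 ⟨f, x⟩ f`. -/
noncomputable def reflMatrix (f : Amb n) : Matrix (Fin (n + 1)) (Fin (n + 1)) ℂ :=
  1 - (2 : ℂ) • Matrix.vecMulVec f.ofLp (star f.ofLp)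

theorem star_dotProduct_self {f : Amb n} (hf : ‖f‖ = 1) : star f.ofLp ⬝ᵥ f.ofLp = 1 := by
  have h : inner ℂ f f = (1 : ℂ) := by
    rw [inner_self_eq_norm_sq_to_K, hf]; simp
  rw [← h, EuclideanSpace.inner_eq_star_dotProduct, dotProduct_comm]

theorem reflMatrix_mem_unitaryGroup {f : Amb n} (hf : ‖f‖ = 1) :
    reflMatrix f ∈ Matrix.unitaryGroup (Fin (n + 1)) ℂ := by
  have h1 := star_dotProduct_self hf
  have h2 : star (reflMatrix f) = reflMatrix f := by
    rw [reflMatrix, star_sub, star_one, star_smul, Matrix.star_eq_conjTranspose,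
      Matrix.conjTranspose_vecMulVec, star_star]
    simp
  have h3 : Matrix.vecMulVec f.ofLp (star f.ofLp) * Matrix.vecMulVec f.ofLp (star f.ofLp) =
      Matrix.vecMulVec f.ofLp (star f.ofLp) := by
    rw [Matrix.vecMulVec_mul_vecMulVec, h1]
    simp
  rw [Matrix.mem_unitaryGroup_iff, h2, reflMatrix, sub_mul, mul_sub, mul_sub, smul_mul_smul_comm, h3]
  simp only [one_mul, mul_one]
  module

/-- By the rank-one determinant formula this is `1 - 2 |f|²`. A single reflection is thus not
special unitary, whence the products of two. -/
theorem det_reflMatrix {f : Amb n} (hf : ‖f‖ = 1) : (reflMatrix f).det = -1 := by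
  have h1 := star_dotProduct_self hf
  have h2 : reflMatrix f = 1 + Matrix.replicateCol Unit ((-2 : ℂ) • f.ofLp) *
      Matrix.replicateRow Unit (star f.ofLp) := by
    rw [reflMatrix, ← Matrix.vecMulVec_eq, Matrix.smul_vecMulVec]
    module
  rw [h2, Matrix.det_one_add_replicateCol_mul_replicateRow, dotProduct_smul, h1]
  norm_num

theorem toEuclideanCLM_reflMatrix (f x : Amb n) :
    Matrix.toEuclideanCLM (n := Fin (n + 1)) (𝕜 := ℂ) (reflMatrix f) x =
      x - (2 * inner ℂ f x : ℂ) • f := by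
  apply WithLp.ofLp_injective
  rw [Matrix.ofLp_toEuclideanCLM, reflMatrix, Matrix.sub_mulVec, Matrix.one_mulVec,
    Matrix.smul_mulVec, Matrix.vecMulVec_mulVec, EuclideanSpace.inner_eq_star_dotProduct,
    dotProduct_comm]
  ext i
  simp
  ring

/-- The product of the reflections in two unit vectors. -/
noncomputable def reflPair {f g : Amb n} (hf : ‖f‖ = 1) (hg : ‖g‖ = 1) :
    Matrix.specialUnitaryGroup (Fin (n + 1)) ℂ :=
  ⟨reflMatrix f * reflMatrix g, Matrix.mem_specialUnitaryGroup_iff.mpr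
    ⟨mul_mem (reflMatrix_mem_unitaryGroup hf) (reflMatrix_mem_unitaryGroup hg), by
      rw [Matrix.det_mul, det_reflMatrix hf, det_reflMatrix hg]; norm_num⟩⟩

theorem suLin_reflPair {f g : Amb n} (hf : ‖f‖ = 1) (hg : ‖g‖ = 1) (hfg : inner ℂ f g = (0 : ℂ))
    (x : Amb n) : suLin (reflPair hf hg) x =
      x - (2 * inner ℂ f x : ℂ) • f - (2 * inner ℂ g x : ℂ) • g := by
  have h : suLin (reflPair hf hg) x =
      Matrix.toEuclideanCLM (n := Fin (n + 1)) (𝕜 := ℂ) (reflMatrix f)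
        (Matrix.toEuclideanCLM (n := Fin (n + 1)) (𝕜 := ℂ) (reflMatrix g) x) :=
    congrArg (fun L ↦ L x) (map_mul (Matrix.toEuclideanCLM (n := Fin (n + 1)) (𝕜 := ℂ))
      (reflMatrix f) (reflMatrix g))
  rw [h, toEuclideanCLM_reflMatrix, toEuclideanCLM_reflMatrix, inner_sub_right, inner_smul_right,
    hfg]
  simp only [mul_zero, sub_zero]
  abel

theorem suLin_reflPair_basis (f : OrthonormalBasis (Fin (n + 1)) ℂ (Amb n)) {a b : Fin (n + 1)}
    (hab : a ≠ b) (j : Fin (n + 1)) (α : ℂ) :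
    suLin (reflPair (f.norm_eq_one a) (f.norm_eq_one b)) (α • f j) =
      (if j = a ∨ j = b then -1 else 1 : ℝ) • (α • f j) := by
  rw [suLin_reflPair _ _ (by rw [f.inner_eq_ite, if_neg hab])]
  simp only [inner_smul_right, f.inner_eq_ite]
  by_cases h1 : j = a
  · subst h1
    simp [hab.symm]
    module
  · by_cases h2 : j = b
    · subst h2
      simp [hab]
      module
    · simp [h1, h2, Ne.symm h1, Ne.symm h2]

/-! ### Skew tensors invariant under the isotropy group -/

theorem inner_complex_eq (x y : Amb n) : inner ℂ x y =
    ((inner ℝ x y : ℝ) : ℂ) + ((inner ℝ (Complex.I • x) y : ℝ) : ℂ) * Complex.I := by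
  have h : ∀ a b : Amb n, (inner ℝ a b : ℝ) = (inner ℂ a b : ℂ).re := fun a b ↦ by
    simp [PiLp.inner_apply]
  rw [h, h, inner_smul_left]
  apply Complex.ext <;> simp

theorem exists_orthonormalBasis_zero (z : OddSphere n) :
    ∃ f : OrthonormalBasis (Fin (n + 1)) ℂ (Amb n), f 0 = z := by
  have hc : finrank ℂ (Amb n) = Fintype.card (Fin (n + 1)) := by
    rw [finrank_euclideanSpace]
  obtain ⟨b, hb⟩ := Orthonormal.exists_orthonormalBasis_extension_of_card_eq (𝕜 := ℂ) hc
    (v := fun _ : Fin (n + 1) ↦ (z : Amb n)) (s := {0}) (by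
      rw [orthonormal_iff_ite]
      intro i j
      have hij : i = j := Subsingleton.elim _ _
      simp [hij])
  exact ⟨b, hb 0 rfl⟩

/-- For `n ≥ 4` a three-form invariant under the isotropy group vanishes on the complex orthogonal
complement of `z`. -/
theorem inner_eq_zero_of_invariant (hn : 4 ≤ n) (z : OddSphere n)
    (B : Amb n →L[ℝ] Amb n →L[ℝ] Amb n)
    (h1 : ∀ w x y, (inner ℝ (B w x) y : ℝ) = -inner ℝ (B x w) y)
    (h2 : ∀ w x y, (inner ℝ (B w x) y : ℝ) = -inner ℝ (B w y) x)
    (hinv : ∀ σ : Matrix.specialUnitaryGroup (Fin (n + 1)) ℂ, suLin σ (z : Amb n) = z →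
      ∀ w x y, (inner ℝ (B (suLin σ w) (suLin σ x)) (suLin σ y) : ℝ) = inner ℝ (B w x) y)
    {w x y : Amb n} (hw : inner ℂ (z : Amb n) w = (0 : ℂ)) (hx : inner ℂ (z : Amb n) x = (0 : ℂ))
    (hy : inner ℂ (z : Amb n) y = (0 : ℂ)) : (inner ℝ (B w x) y : ℝ) = 0 := by
  obtain ⟨f, hf⟩ := exists_orthonormalBasis_zero z
  -- The form is only real multilinear, so the test vectors are all complex multiples of the basis
  -- vectors other than `f 0 = z`.
  have hlin : ∀ v : Amb n, (∀ j ≠ 0, ∀ α : ℂ, (inner ℝ v (α • f j) : ℝ) = 0) →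
      ∀ x, inner ℂ (z : Amb n) x = (0 : ℂ) → (inner ℝ v x : ℝ) = 0 := by
    intro v hv x hx
    rw [← f.sum_repr' x, inner_sum]
    refine Finset.sum_eq_zero fun j _ ↦ ?_
    by_cases hj : j = 0
    · rw [hj, hf, hx, zero_smul, inner_zero_right]
    · exact hv j hj _
  have t1 : ∀ i ≠ 0, ∀ j ≠ 0, ∀ k ≠ 0, ∀ α β γ : ℂ,
      (inner ℝ (B (α • f i) (β • f j)) (γ • f k) : ℝ) = 0 := by
    intro i hi j hj k hk α β γ
    -- A fifth index exists since `n + 1 ≥ 5`. For `n = 3` the real part of the complex volume form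
    -- of the complement of `z` is a nonzero invariant.
    obtain ⟨m, hm⟩ : ∃ m, m ∉ ({0, i, j, k} : Finset (Fin (n + 1))) := by
      by_contra! h
      have h5 : (Finset.univ : Finset (Fin (n + 1))).card ≤ ({0, i, j, k} : Finset _).card :=
        Finset.card_le_card fun a _ ↦ h a
      have h6 : ({0, i, j, k} : Finset (Fin (n + 1))).card ≤ 4 := Finset.card_le_four
      rw [Finset.card_univ, Fintype.card_fin] at h5
      omega
    simp only [Finset.mem_insert, Finset.mem_singleton, not_or] at hm
    obtain ⟨hm0, hmi, hmj, hmk⟩ := hm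
    -- Some index `l` occurs an odd number of times among `i, j, k`. Reflecting in `f l` and `f m`
    -- fixes `z` and changes the sign of the value.
    obtain ⟨l, hl0, hlm, hs⟩ : ∃ l : Fin (n + 1), l ≠ 0 ∧ l ≠ m ∧
        ((if i = l ∨ i = m then -1 else 1 : ℝ) * ((if j = l ∨ j = m then -1 else 1) *
          (if k = l ∨ k = m then -1 else 1)) = -1) := by
      by_cases hij : i = j
      · refine ⟨k, hk, Ne.symm hmk, ?_⟩
        subst hij
        by_cases hik : i = k <;> simp [hik, Ne.symm hmi, Ne.symm hmk]
      · by_cases hik : i = k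
        · subst hik
          exact ⟨j, hj, Ne.symm hmj, by simp [hij, Ne.symm hmi]⟩
        · exact ⟨i, hi, Ne.symm hmi, by
            simp [Ne.symm hij, Ne.symm hik, Ne.symm hmj, Ne.symm hmk]⟩
    have hz : suLin (reflPair (f.norm_eq_one l) (f.norm_eq_one m)) (z : Amb n) = z := by
      have h := suLin_reflPair_basis f hlm 0 1
      rw [if_neg (by simp [Ne.symm hl0, Ne.symm hm0]), one_smul, one_smul, hf] at h
      exact h
    have h := hinv _ hz (α • f i) (β • f j) (γ • f k)
    rw [suLin_reflPair_basis f hlm, suLin_reflPair_basis f hlm, suLin_reflPair_basis f hlm] at h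
    generalize α • f i = u₁ at h ⊢
    generalize β • f j = u₂ at h ⊢
    generalize γ • f k = u₃ at h ⊢
    rw [map_smul, map_smul, smul_apply, inner_smul_left, inner_smul_left, inner_smul_right] at h
    simp only [RCLike.conj_to_real] at h
    have h3 : ∀ a b c t : ℝ, a * (b * (c * t)) = (b * (a * c)) * t := by intros; ring
    rw [h3, hs] at h
    linarith
  have hcyc : ∀ w x y, (inner ℝ (B w x) y : ℝ) = inner ℝ (B x y) w := by
    intro w x y
    rw [h1, h2, neg_neg]
  have t2 : ∀ i ≠ 0, ∀ j ≠ 0, ∀ α β : ℂ, ∀ y, inner ℂ (z : Amb n) y = (0 : ℂ) →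
      (inner ℝ (B (α • f i) (β • f j)) y : ℝ) = 0 := fun i hi j hj α β ↦
    hlin _ fun k hk γ ↦ t1 i hi j hj k hk α β γ
  have t3 : ∀ i ≠ 0, ∀ α : ℂ, ∀ x, inner ℂ (z : Amb n) x = (0 : ℂ) → ∀ y,
      inner ℂ (z : Amb n) y = (0 : ℂ) → (inner ℝ (B (α • f i) x) y : ℝ) = 0 :=
    fun i hi α x hx ↦ hlin _ fun j hj β ↦ by
      rw [h2, t2 i hi j hj α β x hx, neg_zero]
  rw [hcyc]
  refine hlin _ (fun i hi α ↦ ?_) w hw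
  rw [← hcyc]
  exact t3 i hi α x hx y hy

/-- An invariant three-form whose contraction with itself is a multiple of the metric vanishes. -/
theorem eq_zero_of_invariant_of_einstein (hn : 4 ≤ n) (z : OddSphere n)
    (B : Amb n →L[ℝ] Amb n →L[ℝ] Amb n)
    (h1 : ∀ w x y, (inner ℝ (B w x) y : ℝ) = -inner ℝ (B x w) y)
    (h2 : ∀ w x y, (inner ℝ (B w x) y : ℝ) = -inner ℝ (B w y) x) (h0 : B z = 0)
    (hinv : ∀ σ : Matrix.specialUnitaryGroup (Fin (n + 1)) ℂ, suLin σ (z : Amb n) = z →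
      ∀ w x y, (inner ℝ (B (suLin σ w) (suLin σ x)) (suLin σ y) : ℝ) = inner ℝ (B w x) y)
    {ι : Type*} [Fintype ι] (e : OrthonormalBasis ι ℝ (Amb n)) {c : ℝ}
    (hE : ∀ x, ∑ k, (inner ℝ (B x (e k)) (B x (e k)) : ℝ) =
      c * (inner ℝ x x - inner ℝ (z : Amb n) x * inner ℝ x (z : Amb n))) (x y : Amb n) :
    B x y = 0 := by
  -- This is minus the Hopf vector; the sign plays no role. Below, `P` removes the components along
  -- `z` and `ξ`, which is the projection to the complex orthogonal complement of `z`.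
  set ξ : Amb n := Complex.I • (z : Amb n) with hξ
  have hzz := inner_self_sphere z
  have hξξ : (inner ℝ ξ ξ : ℝ) = 1 := by rw [hξ, inner_I_smul_I_smul, hzz]
  have hzξ : (inner ℝ (z : Amb n) ξ : ℝ) = 0 := inner_I_smul_self _
  have hξz : (inner ℝ ξ (z : Amb n) : ℝ) = 0 := by rw [real_inner_comm, hzξ]
  have hcyc : ∀ w x y, (inner ℝ (B w x) y : ℝ) = inner ℝ (B x y) w := by
    intro w x y
    rw [h1, h2, neg_neg]
  have hBz : ∀ x, B x z = 0 := by
    intro x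
    rw [← inner_self_eq_zero (𝕜 := ℝ), h1, h0]
    simp
  have hBzr : ∀ x y, (inner ℝ (B x y) (z : Amb n) : ℝ) = 0 := by
    intro x y
    rw [h2, hBz]
    simp
  have hself : ∀ x y, (inner ℝ (B x y) x : ℝ) = 0 := by
    intro x y
    have h := h1 x x y
    rw [h2 x x y, neg_neg] at h
    linarith
  set P : Amb n → Amb n := fun x ↦ x - (inner ℝ (z : Amb n) x : ℝ) • (z : Amb n) -
    (inner ℝ ξ x : ℝ) • ξ with hP
  have hPz : ∀ x, inner ℂ (z : Amb n) (P x) = (0 : ℂ) := by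
    intro x
    rw [inner_complex_eq, hP]
    simp only [inner_sub_right, inner_smul_right, hzz, hzξ, ← hξ, hξz, hξξ]
    simp
  have hBP : ∀ x y, B x y = B (P x) y + (inner ℝ ξ x : ℝ) • B ξ y := by
    intro x y
    rw [hP]
    simp only [map_sub, map_smul, h0, sub_apply, smul_apply]
    simp
  have hLP : ∀ x y, (inner ℝ (B ξ x) (P y) : ℝ) = inner ℝ (B ξ x) y := by
    intro x y
    rw [hP]
    simp only [inner_sub_right, inner_smul_right, hBzr, hself]
    simp
  -- Split each argument by `P`: the purely horizontal component vanishes by invariance, so the form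
  -- is the wedge of `ξ` with `B ξ`.
  have hform : ∀ x y, B x y = (inner ℝ ξ x : ℝ) • B ξ y - (inner ℝ ξ y : ℝ) • B ξ x +
      (inner ℝ (B ξ x) y : ℝ) • ξ := by
    intro x y
    refine ext_inner_right ℝ fun w ↦ ?_
    have e1 : (inner ℝ (B x y) w : ℝ) = inner ℝ (B (P x) y) w + inner ℝ ξ x * inner ℝ (B ξ y) w := by
      rw [hBP x y, inner_add_left, inner_smul_left]; simp
    have e2 : (inner ℝ (B (P x) y) w : ℝ) =
        inner ℝ (B (P y) w) (P x) + inner ℝ ξ y * inner ℝ (B ξ w) x := by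
      rw [hcyc, hBP y w, inner_add_left, inner_smul_left, hLP]; simp
    have e3 : (inner ℝ (B (P y) w) (P x) : ℝ) = inner ℝ ξ w * inner ℝ (B ξ x) y := by
      rw [hcyc, hBP w (P x), inner_add_left, inner_smul_left, hLP,
        inner_eq_zero_of_invariant hn z B h1 h2 hinv (hPz w) (hPz x) (hPz y), h2 ξ (P x) y, hLP,
        ← h2 ξ x y]
      simp
    rw [e1, e2, e3, h2 ξ w x, inner_add_left, inner_sub_left, inner_smul_left, inner_smul_left,
      inner_smul_left]
    simp only [RCLike.conj_to_real]
    ring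
  set S : ℝ := ∑ k, inner ℝ (B ξ (e k)) (B ξ (e k)) with hS
  -- The Einstein condition at `x = ξ`.
  have hSc : S = c := by
    rw [hS, hE, hξξ, hzξ]; ring
  have hsum : ∀ a b : Amb n, ∑ k, (inner ℝ a (e k) * inner ℝ (e k) b : ℝ) = inner ℝ a b :=
    fun a b ↦ e.sum_inner_mul_inner a b
  have hQ : ∀ x, ∑ k, (inner ℝ (B x (e k)) (B x (e k)) : ℝ) =
      inner ℝ ξ x ^ 2 * S + 2 * inner ℝ (B ξ x) (B ξ x) := by
    intro x
    have hk : ∀ k, (inner ℝ (B x (e k)) (B x (e k)) : ℝ) =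
        inner ℝ ξ x ^ 2 * inner ℝ (B ξ (e k)) (B ξ (e k)) +
        inner ℝ (B ξ x) (B ξ x) * (inner ℝ ξ (e k) * inner ℝ (e k) ξ) +
        inner ℝ (B ξ x) (e k) * inner ℝ (e k) (B ξ x) +
        2 * inner ℝ ξ x * (inner ℝ ξ (e k) * inner ℝ (e k) (B ξ (B ξ x))) := by
      intro k
      have e1 : (inner ℝ (B ξ (e k)) (B ξ x) : ℝ) = -inner ℝ (e k) (B ξ (B ξ x)) := by
        rw [h2, real_inner_comm]
      have e2 : (inner ℝ (B ξ x) (B ξ (e k)) : ℝ) = -inner ℝ (e k) (B ξ (B ξ x)) := by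
        rw [real_inner_comm, e1]
      rw [hform x (e k)]
      simp only [inner_add_left, inner_sub_left, inner_add_right, inner_sub_right, inner_smul_left,
        inner_smul_right, RCLike.conj_to_real, hself, hξξ, e1, e2, real_inner_comm (B ξ _) ξ]
      rw [real_inner_comm ξ (e k), real_inner_comm (B ξ x) (e k)]
      ring
    rw [Finset.sum_congr rfl fun k _ ↦ hk k]
    simp only [Finset.sum_add_distrib, ← Finset.mul_sum, hsum, hξξ]
    rw [real_inner_comm (B ξ (B ξ x)) ξ, hself, ← hS]
    ring
  have hcard : (Fintype.card ι : ℝ) = 2 * n + 2 := by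
    have h := (Module.finrank_eq_card_basis e.toBasis).symm.trans (finrankFact n).out
    rw [h]; push_cast; ring
  have hc : c = 0 := by
    have hx : ∀ k, c * (1 - inner ℝ (z : Amb n) (e k) * inner ℝ (e k) (z : Amb n)) =
        (inner ℝ ξ (e k) * inner ℝ (e k) ξ) * c + 2 * inner ℝ (B ξ (e k)) (B ξ (e k)) := by
      intro k
      have h := (hE (e k)).symm.trans (hQ (e k))
      rw [real_inner_self_eq_norm_sq (e k), e.norm_eq_one, hSc] at h
      rw [real_inner_comm ξ (e k), ← sq, ← h]
      ring
    have h := Finset.sum_congr (rfl : (Finset.univ : Finset ι) = Finset.univ) fun k _ ↦ hx k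
    simp only [Finset.sum_add_distrib, ← Finset.mul_sum, ← Finset.sum_mul, Finset.sum_sub_distrib,
      hsum, hξξ, hzz, Finset.sum_const, Finset.card_univ, nsmul_eq_mul, hcard] at h
    -- Summed over the basis, the Einstein condition reads `(2n + 1) c = c + 2c`.
    rw [← hS, hSc] at h
    have hn' : (4 : ℝ) ≤ n := by exact_mod_cast hn
    have h' : c * (2 * n - 2) = 0 := by linarith
    rcases mul_eq_zero.mp h' with h | h
    · exact h
    · linarith
  have hL : ∀ x, B ξ x = 0 := by
    intro x
    have h := (hE x).symm.trans (hQ x)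
    rw [hSc, hc] at h
    rw [← inner_self_eq_zero (𝕜 := ℝ)]
    linarith
  rw [hform x y, hL, hL]
  simp

end

section

/-! ### Invariant Einstein connections with skew torsion -/

variable {n : ℕ}

theorem ambTensor_tanProj (A : ∀ z : OddSphere n, TS n z →L[ℝ] TS n z →L[ℝ] TS n z)
    (z : OddSphere n) (w x : Amb n) :
    ambTensor A z (dIncl z (tanProj z w)) x = ambTensor A z w x := by
  rw [ambTensor, tanProj_dIncl]; rfl

theorem roundInner_tanProj (z : OddSphere n) (x : Amb n) :
    roundInner z (tanProj z x) (tanProj z x) =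
      inner ℝ x x - inner ℝ (z : Amb n) x * inner ℝ x (z : Amb n) := by
  rw [roundInner_apply, inner_dIncl_tanProj, dIncl_tanProj, inner_sub_right, inner_smul_right]

theorem diffTensor_eq_zero (hn : 4 ≤ n) {D : Connection n} (hD : D.ContMDiffCovariantDerivative ∞)
    (hinv : IsSUInvariant D) (hE : IsEinsteinWithSkewTorsion (roundMetric n) D)
    (z : OddSphere n) : diffTensor D z = 0 := by
  obtain ⟨hM, hT, hR⟩ := hE
  obtain ⟨β, hβ⟩ := exists_isTensorExtension_diffTensor hD z
  have hβ0 := hβ.2.self_of_nhds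
  have hA := isSkewTensor_diffTensor hM hT
  let e := stdOrthonormalBasis ℝ (Amb n)
  have hB : ∀ x y, β z x y = 0 := by
    refine eq_zero_of_invariant_of_einstein hn z (β z) ?_ ?_ ?_ ?_ e
      -- By `symRicci_eq` the contraction of `A` is `2n g - Sym Ric`, and the Einstein condition
      -- makes this a multiple of `g` with this factor.
      (c := 2 * n - scalarCurvature (roundMetric n) D z /
        finrank ℝ (EuclideanSpace ℝ (Fin (2 * n + 1)))) ?_
    · intro w x y
      rw [hβ0, hβ0]; exact (hA z).amb_swap w x y
    · intro w x y
      rw [hβ0, hβ0]; exact (hA z).amb_swap' w x y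
    · ext1 x
      rw [hβ0, ambTensor, tanProj_self]
      simp
    · intro σ hσ w x y
      have hz : suAct σ⁻¹ z = z := by
        apply Subtype.ext
        rw [coe_suAct]
        conv_lhs => rw [← hσ]
        exact suLin_inv_apply' σ _
      rw [hβ0, hβ0, hinv.ambTensor_suLin, hz, inner_suLin]
    · intro x
      have h1 := hR z (tanProj z x) (tanProj z x)
      have h2 := (isLeviCivitaPlus_diffTensor D).symRicci_eq e hβ hA (tanProj z x) (tanProj z x)
      simp only [ambTensor_tanProj] at h2
      have h3 : (roundMetric n).inner z (tanProj z x) (tanProj z x) =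
        roundInner z (tanProj z x) (tanProj z x) := rfl
      rw [h3] at h1
      simp only [hβ0]
      rw [← roundInner_tanProj]
      linarith
  ext1 u
  ext1 v
  apply dIncl_injective z
  rw [← ambTensor_dIncl, ← hβ0, hB]
  simp

theorem einstein_of_diffTensor_eq_zero {D : Connection n} (hD : D.ContMDiffCovariantDerivative ∞)
    (h0 : ∀ z, diffTensor D z = 0) (z : OddSphere n) (u v : TS n z) :
    symRicci D z u v = scalarCurvature (roundMetric n) D z /
      finrank ℝ (EuclideanSpace ℝ (Fin (2 * n + 1))) * (roundMetric n).inner z u v := by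
  have hR : ∀ u v : TS n z, symRicci D z u v =
      2 * n * roundInner z u v + 0 * (eta z u * eta z v) := by
    intro u v
    obtain ⟨β, hβ⟩ := exists_isTensorExtension_diffTensor hD z
    have hA : ∀ q, IsSkewTensor (diffTensor D) q := fun q u v w ↦ by simp [h0]
    rw [(isLeviCivitaPlus_diffTensor D).symRicci_eq (stdOrthonormalBasis ℝ (Amb n)) hβ hA]
    simp [ambTensor, h0]
  rw [hR, scalarCurvature_of_symRicci hR, finrank_euclideanSpace_fin]
  have h : (roundMetric n).inner z u v = roundInner z u v := rfl
  have h' : (2 * (n : ℝ) + 1) ≠ 0 := by positivity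
  rw [h]
  push_cast
  field_simp
  ring

/-- Smooth fields suffice because projections of constant vectors take every tangent value. Equality
is not asked on non-differentiable sections, where the axioms do not constrain a
`CovariantDerivative`. -/
theorem diffTensor_eq_zero_of_eq {D : Connection n}
    (h : ∀ Y : ∀ z : OddSphere n, TS n z, IsSmoothField (𝓡 (2 * n + 1)) Y →
      ∀ z : OddSphere n, D Y z = leviCivita n Y z) (z : OddSphere n) : diffTensor D z = 0 := by
  ext1 u
  ext1 v
  apply dIncl_injective z
  rw [← ambTensor_dIncl, ambTensor_diffTensor, h _ (isSmoothField_projField _), sub_self]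
  simp

theorem isSUInvariant_of_eq {D : Connection n}
    (h : ∀ Y : ∀ z : OddSphere n, TS n z, IsSmoothField (𝓡 (2 * n + 1)) Y →
      ∀ z : OddSphere n, D Y z = leviCivita n Y z) : IsSUInvariant D := by
  intro σ X Y hX hY
  simp only [h _ hY, h _ (isSmoothField_pushforward σ hY)]
  exact leviCivita_isSUInvariant n σ X Y hX hY

theorem isMetric_of_eq {D : Connection n}
    (h : ∀ Y : ∀ z : OddSphere n, TS n z, IsSmoothField (𝓡 (2 * n + 1)) Y →
      ∀ z : OddSphere n, D Y z = leviCivita n Y z) : IsMetric (roundMetric n) D := by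
  intro X Y Z hX hY hZ p
  rw [h _ hY, h _ hZ]
  exact leviCivita_isMetric n X Y Z hX hY hZ p

theorem isEinsteinWithSkewTorsion_of_eq {D : Connection n} (hD : D.ContMDiffCovariantDerivative ∞)
    (h : ∀ Y : ∀ z : OddSphere n, TS n z, IsSmoothField (𝓡 (2 * n + 1)) Y →
      ∀ z : OddSphere n, D Y z = leviCivita n Y z) :
    IsEinsteinWithSkewTorsion (roundMetric n) D := by
  have h0 := diffTensor_eq_zero_of_eq h
  refine ⟨isMetric_of_eq h, fun p u v w ↦ ?_, einstein_of_diffTensor_eq_zero hD h0⟩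
  simp [torsion_eq_diffTensor, h0]

end

end RiemannCartan

/-! ### The theorem. -/

theorem mainTheorem7 (n : ℕ) (hn : 1 ≤ n) :
    (∀ (r : ℝ) (z : OddSphere n),
      (∀ u v : TS n z, symRicci (skewConnection n r) z u v =
        2 * ((n : ℝ) - r ^ 2) * (roundMetric n).inner z u v
          - 2 * ((n : ℝ) - 1) * r ^ 2 * (eta z u * eta z v)) ∧
      scalarCurvature (roundMetric n) (skewConnection n r) z =
        2 * (n : ℝ) * (2 * (n : ℝ) + 1) - 6 * (n : ℝ) * r ^ 2) ∧
    (4 ≤ n → ∀ D : Connection n, D.ContMDiffCovariantDerivative ∞ →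
      ((IsSUInvariant D ∧ IsEinsteinWithSkewTorsion (roundMetric n) D) ↔
        ∀ Y : ∀ z : OddSphere n, TS n z, IsSmoothField (𝓡 (2 * n + 1)) Y →
          ∀ z : OddSphere n, D Y z = leviCivita n Y z)) := by
  refine ⟨fun r z ↦ ⟨fun u v ↦ ?_, scalarCurvature_skewConnection r z⟩, fun hn4 D hD ↦
    ⟨fun ⟨hinv, hE⟩ Y hY z ↦ ?_, fun h ↦
      ⟨isSUInvariant_of_eq h, isEinsteinWithSkewTorsion_of_eq hD h⟩⟩⟩
  · have h : (roundMetric n).inner z u v = roundInner z u v := rfl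
    rw [symRicci_skewConnection, h]
    ring
  · ext1 u
    rw [isLeviCivitaPlus_diffTensor D Y z ((hY z).mdifferentiableAt (by simp)),
      diffTensor_eq_zero hn4 hD hinv hE z]
    simp
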